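/- Let $\mu$ be a nontrivial (i.e. not supported on a finite set) probability measure on the unit circle $\{|z|=1\}$, let $(\Phi_n)_{n\ge 0}$ be its monic orthogonal polynomials, $\Phi_n(z)=z^n+\cdots$, $\int \Phi_m\overline{\Phi_n}\,d\mu=0$ for $m\neq n$, and let $\alpha_n=-\overline{\Phi_{n+1}(0)}$, $n\ge 0$, be its Verblunsky coefficients. For a function $f$ on the circle write $f_k=\int_{-\pi}^{\pi}e^{-ik\theta}f(e^{i\theta})\,\frac{d\theta}{2\pi}$, and let $H^{1/2}$ be the space of $f\in L^2$ with $\sum_{k\in\mathbb Z}|k|\,|f_k|^2<\infty$. Suppose that $d\mu=w\,\frac{|dz|}{2\pi}$ with $w>0$ almost everywhere and $f=\log w\in H^{1/2}$ (real-valued). Put $$r=\exp\Big(-\sum_{k>0}f_kz^k+\sum_{k<0}f_kz^k\Big),$$ the series converging in $L^2$, and $\rho(n_0)=\Big(\sum_{n\ge n_0}(n+1)|r_n|^2\Big)^{1/2}$. Then $\sum_{n\ge0}n|\alpha_n|^2<\infty$. Moreover, $r\in H^{1/2}$, so that $\rho(n_0)<1$ for all sufficiently large $n_0$, and for every $n_0\ge1$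 with $\rho(n_0)<1$, $$\Big(\sum_{n\ge n_0}n\,|\alpha_{n-1}|^2\Big)^{1/2}\le\frac{\rho(n_0)}{1-\rho(n_0)^2}.$$ -/

import Mathlib

open MeasureTheory AddCircle Polynomial

noncomputable section

/-! The unit circle is modelled as `AddCircle (2 * Real.pi)` (the angle `θ` modulo `2π`); its point is
`z = e^{iθ} = fourier 1 θ`. The measure `haarAddCircle` is `|dz| / 2π = dθ / 2π`, and
`fourierCoeff f k` is `∫ e^{-ikθ} f(e^{iθ}) dθ / 2π`. -/

instance fact_zero_lt_two_pi : Fact (0 < 2 * Real.pi) := ⟨Real.two_pi_pos⟩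

/-- A measure on the circle is nontrivial if it is not carried by a finite set of points. -/
def IsNontrivialMeasure (μ : Measure (AddCircle (2 * Real.pi))) : Prop :=
  ∀ s : Set (AddCircle (2 * Real.pi)), s.Finite → μ sᶜ ≠ 0

/-- The pairing `⟨p, q⟩ = ∫ p(z) conj(q(z)) dμ(z)` of two polynomials. -/
def circleInner (μ : Measure (AddCircle (2 * Real.pi))) (p q : ℂ[X]) : ℂ :=
  ∫ θ, p.eval (fourier 1 θ) * (starRingEnd ℂ) (q.eval (fourier 1 θ)) ∂μ

/-- The monic orthogonal polynomials `Φ_n` of `μ`, by the Gram–Schmidt process applied to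
`1, z, z², …`. -/
def monicOPUC (μ : Measure (AddCircle (2 * Real.pi))) (n : ℕ) : ℂ[X] :=
  X ^ n - ∑ k : Fin n,
    C (circleInner μ (X ^ n) (monicOPUC μ k) / circleInner μ (monicOPUC μ k) (monicOPUC μ k)) *
      monicOPUC μ k
termination_by n
decreasing_by exact k.2

theorem monicOPUC_eq (μ : Measure (AddCircle (2 * Real.pi))) (n : ℕ) :
    monicOPUC μ n = X ^ n - ∑ k : Fin n,
      C (circleInner μ (X ^ n) (monicOPUC μ k) / circleInner μ (monicOPUC μ k) (monicOPUC μ k)) *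
        monicOPUC μ k := by
  rw [monicOPUC]

/-- `Φ_n = z^n + …` is monic of degree `n`. -/
theorem monicOPUC_monic_natDegree (μ : Measure (AddCircle (2 * Real.pi))) (n : ℕ) :
    (monicOPUC μ n).Monic ∧ (monicOPUC μ n).natDegree = n := by
  induction n using Nat.strong_induction_on with
  | _ n ih =>
    have hs : (∑ k : Fin n, C (circleInner μ (X ^ n) (monicOPUC μ k) /
        circleInner μ (monicOPUC μ k) (monicOPUC μ k)) * monicOPUC μ k).degree < (n : ℕ) := by
      rw [← mem_degreeLT]
      refine Submodule.sum_mem _ fun k _ => ?_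
      rw [← smul_eq_C_mul]
      refine Submodule.smul_mem _ _ ?_
      rw [mem_degreeLT]
      refine lt_of_le_of_lt degree_le_natDegree ?_
      rw [(ih k k.2).2]
      exact_mod_cast k.2
    have hs' : (∑ k : Fin n, C (circleInner μ (X ^ n) (monicOPUC μ k) /
        circleInner μ (monicOPUC μ k) (monicOPUC μ k)) * monicOPUC μ k).degree <
        (X ^ n : ℂ[X]).degree := by
      rwa [degree_X_pow]
    rw [monicOPUC_eq]
    refine ⟨(monic_X_pow n).sub_of_left hs', ?_⟩
    apply natDegree_eq_of_degree_eq_some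
    rw [degree_sub_eq_left_of_degree_lt hs', degree_X_pow]

theorem integrable_circleInner (μ : Measure (AddCircle (2 * Real.pi))) [IsFiniteMeasure μ]
    (p q : ℂ[X]) : Integrable (fun θ : AddCircle (2 * Real.pi) =>
      p.eval (fourier 1 θ) * (starRingEnd ℂ) (q.eval (fourier 1 θ))) μ := by
  have hc : Continuous (fun θ : AddCircle (2 * Real.pi) =>
      p.eval (fourier 1 θ) * (starRingEnd ℂ) (q.eval (fourier 1 θ))) := by
    have h1 : Continuous (fun θ : AddCircle (2 * Real.pi) => (fourier 1 θ : ℂ)) :=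
      (fourier 1).continuous
    exact (p.continuous.comp h1).mul (Complex.continuous_conj.comp (q.continuous.comp h1))
  exact hc.integrable_of_hasCompactSupport (HasCompactSupport.of_compactSpace _)

theorem circleInner_conj (μ : Measure (AddCircle (2 * Real.pi))) (p q : ℂ[X]) :
    (starRingEnd ℂ) (circleInner μ p q) = circleInner μ q p := by
  unfold circleInner
  rw [← integral_conj]
  refine integral_congr_ae (Filter.Eventually.of_forall fun θ => ?_)
  simp [mul_comm]

theorem circleInner_self_ne_zero (μ : Measure (AddCircle (2 * Real.pi))) [IsFiniteMeasure μ]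
    (hμ : IsNontrivialMeasure μ) {p : ℂ[X]} (hp : p ≠ 0) : circleInner μ p p ≠ 0 := by
  intro h
  have h1 : circleInner μ p p =
      ((∫ θ : AddCircle (2 * Real.pi), ‖p.eval (fourier 1 θ)‖ ^ 2 ∂μ : ℝ) : ℂ) := by
    unfold circleInner
    rw [← integral_complex_ofReal]
    refine integral_congr_ae (Filter.Eventually.of_forall fun θ => ?_)
    simp [Complex.mul_conj, Complex.normSq_eq_norm_sq]
  rw [h1, Complex.ofReal_eq_zero, integral_eq_zero_iff_of_nonneg (fun θ => by positivity)] at h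
  · refine hμ {θ | p.eval (fourier 1 θ) = 0} ?_ ?_
    · refine Set.Finite.preimage (f := fun θ : AddCircle (2 * Real.pi) => (fourier 1 θ : ℂ))
        (s := {z | p.eval z = 0}) ?_ ?_
      · intro a _ b _ hab
        simp only [fourier_one] at hab
        exact injective_toCircle (by positivity) (Circle.ext hab)
      · refine (p.roots.toFinset.finite_toSet).subset fun z hz => ?_
        simpa [hp] using hz
    · have h2 : ∀ᵐ θ ∂μ, p.eval (fourier 1 θ) = 0 := by
        filter_upwards [h] with θ hθ
        simpa using hθ
      exact h2
  · have := (integrable_circleInner μ p p).norm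
    refine this.congr (Filter.Eventually.of_forall fun θ => ?_)
    simp [sq]

/-- The defining property: for a nontrivial measure the `Φ_n` are orthogonal. -/
theorem circleInner_monicOPUC (μ : Measure (AddCircle (2 * Real.pi))) [IsFiniteMeasure μ]
    (hμ : IsNontrivialMeasure μ) {m n : ℕ} (hmn : m ≠ n) :
    circleInner μ (monicOPUC μ m) (monicOPUC μ n) = 0 := by
  have key : ∀ N : ℕ, ∀ m < N, circleInner μ (monicOPUC μ N) (monicOPUC μ m) = 0 := by
    intro N
    induction N using Nat.strong_induction_on with
    | _ N ih =>
      intro m hm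
      have hsum : circleInner μ (monicOPUC μ N) (monicOPUC μ m) =
          circleInner μ (X ^ N) (monicOPUC μ m) - ∑ k : Fin N,
            circleInner μ (X ^ N) (monicOPUC μ k) / circleInner μ (monicOPUC μ k) (monicOPUC μ k) *
              circleInner μ (monicOPUC μ k) (monicOPUC μ m) := by
        conv_lhs => rw [monicOPUC_eq μ N]
        simp only [circleInner, eval_sub, eval_finsetSum, eval_mul, eval_C, sub_mul,
          Finset.sum_mul, mul_assoc]
        rw [integral_sub (integrable_circleInner μ _ _), integral_finsetSum]
        · simp only [integral_const_mul]
        · exact fun k _ => (integrable_circleInner μ _ _).const_mul _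
        · exact integrable_finsetSum _ fun k _ => (integrable_circleInner μ _ _).const_mul _
      rw [hsum, Finset.sum_eq_single (⟨m, hm⟩ : Fin N)]
      · have := circleInner_self_ne_zero μ hμ (monicOPUC_monic_natDegree μ m).1.ne_zero
        simp [div_mul_cancel₀ _ this]
      · intro k _ hk
        have hk' : (k : ℕ) ≠ m := fun h => hk (Fin.ext h)
        rcases lt_or_gt_of_ne hk' with h | h
        · rw [← circleInner_conj μ (monicOPUC μ m), ih m hm k h, map_zero, mul_zero]
        · rw [ih k k.2 m h, mul_zero]
      · simp
  rcases lt_or_gt_of_ne hmn with h | h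
  · rw [← circleInner_conj μ (monicOPUC μ n), key n m h, map_zero]
  · exact key m n h

/-- The Verblunsky coefficients `α_n = - conj (Φ_{n+1}(0))`. -/
def verblunsky (μ : Measure (AddCircle (2 * Real.pi))) (n : ℕ) : ℂ :=
  -(starRingEnd ℂ) ((monicOPUC μ (n + 1)).eval 0)

/-- Membership in the Sobolev space `H^{1/2}` of the circle. -/
def MemHHalf (f : AddCircle (2 * Real.pi) → ℂ) : Prop :=
  MemLp f 2 haarAddCircle ∧ Summable fun l : ℤ => |(l : ℝ)| * ‖fourierCoeff f l‖ ^ 2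

/-- `I(f) = - ∑_{k > 0} f_k z^k + ∑_{k < 0} f_k z^k`, the series being taken in `L²`. -/
def oddSeries (f : AddCircle (2 * Real.pi) → ℂ) :
    Lp ℂ 2 (haarAddCircle : Measure (AddCircle (2 * Real.pi))) :=
  ∑' k : ℤ, (-(k.sign : ℂ) * fourierCoeff f k) • fourierLp 2 k

/-- For `f` in `L²` the series `I(f)` converges and has the intended Fourier coefficients. -/
theorem fourierCoeff_oddSeries (f : AddCircle (2 * Real.pi) → ℂ) (hf : MemLp f 2 haarAddCircle)
    (k : ℤ) : fourierCoeff (oddSeries f) k = -(k.sign : ℂ) * fourierCoeff f k := by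
  have h0 : Memℓp (fun l : ℤ => fourierCoeff f l) 2 := by
    have e : (fun l : ℤ => fourierCoeff f l) = ⇑(fourierBasis.repr (hf.toLp f)) := by
      funext l
      rw [fourierBasis_repr]
      exact (congrFun (fourierCoeff_congr_ae hf.coeFn_toLp) l).symm
    rw [e]
    exact lp.memℓp _
  have h1 : Memℓp (fun l : ℤ => -(l.sign : ℂ) * fourierCoeff f l) 2 := by
    refine memℓp_gen ?_
    refine (h0.summable (by simp)).of_nonneg_of_le (fun l => by positivity) fun l => ?_
    refine Real.rpow_le_rpow (norm_nonneg _) ?_ (by simp)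
    rw [norm_mul, norm_neg]
    have : ‖((l.sign : ℤ) : ℂ)‖ ≤ 1 := by
      rcases lt_trichotomy l 0 with h | h | h
      · simp [Int.sign_eq_neg_one_of_neg h]
      · simp [h]
      · simp [Int.sign_eq_one_of_pos h]
    exact mul_le_of_le_one_left (norm_nonneg _) this
  have h2 := (fourierBasis (T := 2 * Real.pi)).hasSum_repr_symm (⟨_, h1⟩ : lp (fun _ : ℤ => ℂ) 2)
  rw [coe_fourierBasis] at h2
  have h3 : oddSeries f = fourierBasis.repr.symm (⟨_, h1⟩ : lp (fun _ : ℤ => ℂ) 2) := h2.tsum_eq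
  rw [← fourierBasis_repr, h3, LinearIsometryEquiv.apply_symm_apply]

/-- `B(f) = exp (I(f))`. For `f = log w` this is the function `r = conj(D) / D`, with `D` the
boundary values of the Szegő function of `w` from inside the disc. -/
def expOddSeries (f : AddCircle (2 * Real.pi) → ℂ) (θ : AddCircle (2 * Real.pi)) : ℂ :=
  Complex.exp (oddSeries f θ)

/-- The function `r = B(log w)`. -/
def reflectionFn (w : AddCircle (2 * Real.pi) → ℝ) : AddCircle (2 * Real.pi) → ℂ :=
  expOddSeries fun θ => (Real.log (w θ) : ℂ)

/-- `ρ(n₀) = (∑_{n ≥ n₀} (n + 1) |r_n|²)^{1/2}`. -/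
def tailRho (w : AddCircle (2 * Real.pi) → ℝ) (n₀ : ℕ) : ℝ :=
  Real.sqrt (∑' k : ℕ, (((n₀ + k : ℕ) : ℝ) + 1) *
    ‖fourierCoeff (reflectionFn w) ((n₀ + k : ℕ) : ℤ)‖ ^ 2)

end

/-! Write `f = F + conj F + f₀` with `F` analytic of mean zero and put `D = exp F`. Then `w =
exp(f₀) |D|²` and `r = conj D / D` is unimodular. The two analytic inputs are that `D` and `1/D` lie
in the Hardy space `H²` (`memLp_exp_of_analytic`, from a Lebedev–Milin bound) and that `r` is in
`H^{1/2}` (Douglas' formula, since `exp` is 1-Lipschitz on the imaginary axis).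

Orthogonality of `Φ_n` becomes a problem about `r` alone. Seek `X` with frequencies `≥ n` and `Y`
with frequencies `< 0` such that `p = X + r Y` has frequencies `≤ n` with `p_n = 1`, and `q =
conj(r) p` has frequencies `≥ 0`. Then `q / D = p / conj D` is a monic polynomial of degree `n`,
orthogonal to `1, …, z^{n-1}`; hence it is `Φ_n`, and `Φ_n(0) = q_0` (`monicOPUC_eval_zero_eq`).

The system reads `X = e_n - T Y`, `Y = -T* X`, where `T` is the Hankel operator `P_{≥ n} r P_{< 0}`.
Its Hilbert–Schmidt norm is at most `ρ(n)`, so for `ρ(n) < 1` a Neumann series solves it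
(`exists_hankel_solution`). With `S_n = ∑_{m ≥ n} |r_m|²` and any `ρ < 1` with `ρ(n) ≤ ρ`, the
solution gives `|α_{n-1}| ≤ |r_n| + S_n ρ / (1 - ρ²)`.

Finally, `∑_{n ≥ n₀} n S_n² ≤ ρ(n₀)⁴`, because both `sup n S_n` and `∑ S_n` are at most `ρ(n₀)²`.
Minkowski's inequality with `ρ = ρ(n₀)` bounds the weighted norm by `ρ + ρ² · ρ / (1 - ρ²) = ρ / (1
- ρ²)`. -/

noncomputable section

local notation "𝕋" => AddCircle (2 * Real.pi)
local notation "haar" => (haarAddCircle : Measure (AddCircle (2 * Real.pi)))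

/-! ### Fourier coefficients of square integrable functions -/

theorem norm_fourier_apply (n : ℤ) (t : 𝕋) : ‖(fourier n t : ℂ)‖ = 1 := by
  rw [fourier_apply, Circle.norm_coe]

theorem MeasureTheory.MemLp.fourier_mul {g : 𝕋 → ℂ} (hg : MemLp g 2 haar) (n : ℤ) :
    MemLp (fun t => fourier n t * g t) 2 haar := by
  refine hg.of_le ?_ (Filter.Eventually.of_forall fun t => ?_)
  · exact (map_continuous (fourier n)).aestronglyMeasurable.mul hg.1
  · rw [norm_mul, norm_fourier_apply, one_mul]

theorem MeasureTheory.MemLp.conj {g : 𝕋 → ℂ} (hg : MemLp g 2 haar) :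
    MemLp (fun t => (starRingEnd ℂ) (g t)) 2 haar := by
  refine hg.of_le ?_ (Filter.Eventually.of_forall fun t => ?_)
  · exact Complex.continuous_conj.comp_aestronglyMeasurable hg.1
  · rw [RCLike.norm_conj]

theorem fourierCoeff_conj (g : 𝕋 → ℂ) (k : ℤ) :
    fourierCoeff (fun t => (starRingEnd ℂ) (g t)) k = (starRingEnd ℂ) (fourierCoeff g (-k)) := by
  unfold fourierCoeff
  rw [← integral_conj]
  congr 1; ext t
  simp only [smul_eq_mul, map_mul, fourier_neg, neg_neg]

theorem fourierCoeff_fourier_mul (g : 𝕋 → ℂ) (n k : ℤ) :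
    fourierCoeff (fun t => fourier n t * g t) k = fourierCoeff g (k - n) := by
  unfold fourierCoeff
  congr 1; ext t
  rw [smul_eq_mul, smul_eq_mul, ← mul_assoc, ← fourier_add, neg_sub]
  ring_nf

theorem fourierCoeff_toLp_eq {g : 𝕋 → ℂ} (hg : MemLp g 2 haar) :
    fourierCoeff (hg.toLp g) = fourierCoeff g :=
  fourierCoeff_congr_ae hg.coeFn_toLp

/-- Parseval's identity. -/
theorem hasSum_fourierCoeff_conj_mul {g h : 𝕋 → ℂ} (hg : MemLp g 2 haar) (hh : MemLp h 2 haar) :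
    HasSum (fun k => (starRingEnd ℂ) (fourierCoeff g k) * fourierCoeff h k)
      (∫ t, (starRingEnd ℂ) (g t) * h t ∂haar) := by
  have := fourierBasis.hasSum_inner_mul_inner (hg.toLp g) (hh.toLp h)
  rw [L2.inner_def] at this
  convert this using 1
  · rfl
  · ext k
    rw [← inner_conj_symm, ← fourierBasis.repr_apply_apply, ← fourierBasis.repr_apply_apply,
      fourierBasis_repr, fourierBasis_repr, fourierCoeff_toLp_eq, fourierCoeff_toLp_eq]
  · refine integral_congr_ae ?_
    filter_upwards [hg.coeFn_toLp, hh.coeFn_toLp] with t h1 h2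
    rw [h1, h2, RCLike.inner_apply']

theorem hasSum_sq_fourierCoeff_of_memLp {g : 𝕋 → ℂ} (hg : MemLp g 2 haar) :
    HasSum (fun k => ‖fourierCoeff g k‖ ^ 2) (∫ t, ‖g t‖ ^ 2 ∂haar) := by
  have := hasSum_sq_fourierCoeff (hg.toLp g)
  rw [fourierCoeff_toLp_eq] at this
  convert this using 1
  refine integral_congr_ae ?_
  filter_upwards [hg.coeFn_toLp] with t h1
  rw [h1]

theorem ae_eq_of_fourierCoeff_eq {g h : 𝕋 → ℂ} (hg : MemLp g 2 haar) (hh : MemLp h 2 haar)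
    (e : ∀ k, fourierCoeff g k = fourierCoeff h k) : g =ᵐ[haar] h := by
  have : hg.toLp g = hh.toLp h := by
    apply fourierBasis.repr.injective
    ext k
    rw [fourierBasis_repr, fourierBasis_repr, fourierCoeff_toLp_eq, fourierCoeff_toLp_eq, e]
  exact (MemLp.toLp_eq_toLp_iff hg hh).1 this

/-- The Riesz–Fischer theorem. -/
theorem exists_memLp_fourierCoeff_eq {c : ℤ → ℂ} (hc : Summable fun k => ‖c k‖ ^ 2) :
    ∃ g : 𝕋 → ℂ, MemLp g 2 haar ∧ ∀ k, fourierCoeff g k = c k := by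
  have h1 : Memℓp c 2 := memℓp_gen (by simpa using hc)
  refine ⟨fourierBasis.repr.symm (⟨c, h1⟩ : lp (fun _ : ℤ => ℂ) 2), Lp.memLp _, fun k => ?_⟩
  rw [← fourierBasis_repr, LinearIsometryEquiv.apply_symm_apply]

/-- The Fourier coefficients of a product are the convolution of the Fourier coefficients. -/
theorem hasSum_fourierCoeff_mul {g h : 𝕋 → ℂ} (hg : MemLp g 2 haar) (hh : MemLp h 2 haar)
    (m : ℤ) : HasSum (fun j => fourierCoeff g (m - j) * fourierCoeff h j)
      (fourierCoeff (fun t => g t * h t) m) := by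
  have := hasSum_fourierCoeff_conj_mul (hg.conj.fourier_mul m) hh
  convert this using 1
  · ext j
    rw [fourierCoeff_fourier_mul, fourierCoeff_conj, RCLike.conj_conj, neg_sub]
  · unfold fourierCoeff
    congr 1; ext t
    rw [smul_eq_mul, fourier_neg, map_mul, RCLike.conj_conj, mul_assoc]

/-- In every term of the convolution one factor vanishes. Such one-sided support rules do the work
of Hardy space theory here: a product of two `L²` functions is only in `L¹`, but its convolution
formula is enough. -/
theorem fourierCoeff_mul_eq_zero_of_lower {g h : 𝕋 → ℂ} (hg : MemLp g 2 haar)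
    (hh : MemLp h 2 haar) {a b : ℤ} (ha : ∀ k < a, fourierCoeff g k = 0)
    (hb : ∀ k < b, fourierCoeff h k = 0) {m : ℤ} (hm : m < a + b) :
    fourierCoeff (fun t => g t * h t) m = 0 := by
  refine (hasSum_fourierCoeff_mul hg hh m).unique ?_
  convert hasSum_zero with j
  rcases lt_or_ge j b with h1 | h1
  · rw [hb j h1, mul_zero]
  · rw [ha _ (by linarith), zero_mul]

theorem fourierCoeff_mul_of_lower {g h : 𝕋 → ℂ} (hg : MemLp g 2 haar)
    (hh : MemLp h 2 haar) {a b : ℤ} (ha : ∀ k < a, fourierCoeff g k = 0)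
    (hb : ∀ k < b, fourierCoeff h k = 0) :
    fourierCoeff (fun t => g t * h t) (a + b) = fourierCoeff g a * fourierCoeff h b := by
  refine (hasSum_fourierCoeff_mul hg hh _).unique ?_
  convert hasSum_single b fun j hj => ?_ using 1
  · rw [add_sub_cancel_right]
  rcases lt_or_gt_of_ne hj with h1 | h1
  · rw [hb j h1, mul_zero]
  · rw [ha _ (by linarith), zero_mul]

theorem fourierCoeff_mul_eq_zero_of_upper {g h : 𝕋 → ℂ} (hg : MemLp g 2 haar)
    (hh : MemLp h 2 haar) {a b : ℤ} (ha : ∀ k > a, fourierCoeff g k = 0)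
    (hb : ∀ k > b, fourierCoeff h k = 0) {m : ℤ} (hm : a + b < m) :
    fourierCoeff (fun t => g t * h t) m = 0 := by
  refine (hasSum_fourierCoeff_mul hg hh m).unique ?_
  convert hasSum_zero with j
  rcases lt_or_ge b j with h1 | h1
  · rw [hb j h1, mul_zero]
  · rw [ha _ (by linarith), zero_mul]

theorem fourierCoeff_mul_of_upper {g h : 𝕋 → ℂ} (hg : MemLp g 2 haar)
    (hh : MemLp h 2 haar) {a b : ℤ} (ha : ∀ k > a, fourierCoeff g k = 0)
    (hb : ∀ k > b, fourierCoeff h k = 0) :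
    fourierCoeff (fun t => g t * h t) (a + b) = fourierCoeff g a * fourierCoeff h b := by
  refine (hasSum_fourierCoeff_mul hg hh _).unique ?_
  convert hasSum_single b fun j hj => ?_ using 1
  · rw [add_sub_cancel_right]
  rcases lt_or_gt_of_ne hj with h1 | h1
  · rw [ha _ (by linarith), zero_mul]
  · rw [hb j h1, mul_zero]

/-- The convolution is finite, so analytic functions multiply like formal power series. -/
theorem fourierCoeff_mul_natCast {g h : 𝕋 → ℂ} (hg : MemLp g 2 haar)
    (hh : MemLp h 2 haar) (ha : ∀ k < 0, fourierCoeff g k = 0)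
    (hb : ∀ k < 0, fourierCoeff h k = 0) (m : ℕ) :
    fourierCoeff (fun t => g t * h t) m =
      ∑ p ∈ Finset.HasAntidiagonal.antidiagonal m, fourierCoeff g p.1 * fourierCoeff h p.2 := by
  refine (hasSum_fourierCoeff_mul hg hh m).unique ?_
  rw [← Finset.Nat.sum_antidiagonal_swap, Finset.Nat.sum_antidiagonal_eq_sum_range_succ_mk]
  have : ∑ k ∈ Finset.range m.succ, fourierCoeff g ((m : ℤ) - k) * fourierCoeff h k =
      ∑ k ∈ (Finset.range m.succ).map Nat.castEmbedding,
        fourierCoeff g ((m : ℤ) - k) * fourierCoeff h k := by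
    rw [Finset.sum_map]; rfl
  convert hasSum_sum_of_ne_finset_zero (f := fun j : ℤ => fourierCoeff g (m - j) * fourierCoeff h j)
    (s := (Finset.range m.succ).map Nat.castEmbedding) fun j hj => ?_ using 1
  · rw [← this]
    refine Finset.sum_congr rfl fun k hk => ?_
    have : k ≤ m := Nat.lt_succ_iff.1 (Finset.mem_range.1 hk)
    simp [Nat.cast_sub this]
  · rcases lt_or_ge j 0 with h1 | h1
    · rw [hb j h1, mul_zero]
    · lift j to ℕ using h1
      rw [ha, zero_mul]
      simp at hj
      omega
  · infer_instance

/-! ### Polynomials on the circle. -/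

theorem fourier_one_pow (n : ℕ) (t : 𝕋) : (fourier 1 t : ℂ) ^ n = fourier n t := by
  induction n with
  | zero => simp
  | succ n ih => rw [pow_succ, ih, ← fourier_add, Nat.cast_succ]

theorem continuous_eval_fourier (P : ℂ[X]) : Continuous fun t : 𝕋 => P.eval (fourier 1 t : ℂ) :=
  P.continuous.comp (fourier 1).continuous

theorem Continuous.memLp_circle {g : 𝕋 → ℂ} (hg : Continuous g) : MemLp g 2 haar :=
  hg.memLp_of_hasCompactSupport (HasCompactSupport.of_compactSpace _)

theorem fourierCoeff_eval (P : ℂ[X]) (k : ℤ) :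
    fourierCoeff (fun t : 𝕋 => P.eval (fourier 1 t : ℂ)) k =
      if 0 ≤ k then P.coeff k.toNat else 0 := by
  induction P using Polynomial.induction_on' with
  | add p q hp hq =>
    have := congrFun (fourierCoeff.add ((continuous_eval_fourier p).memLp_circle.integrable one_le_two)
      ((continuous_eval_fourier q).memLp_circle.integrable one_le_two)) k
    simp only [Pi.add_def] at this
    simp only [eval_add, coeff_add]
    rw [this, hp, hq]
    split_ifs <;> simp
  | monomial n a =>
    simp only [eval_monomial, fourier_one_pow]
    rw [fourierCoeff.const_mul, fourierCoeff_fourier, coeff_monomial]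
    rcases lt_or_ge k 0 with h | h
    · rw [if_neg (by omega), Pi.single_eq_of_ne (by omega), mul_zero]
    · lift k to ℕ using h
      simp [Pi.single_apply, eq_comm]

/-! ### The Lebedev–Milin inequality and exponentials of analytic functions in `H^{1/2}` -/

/-- The recurrence says that `∑ c_k z^k = exp (∑ a_k z^k)`. Cauchy–Schwarz in it makes the partial
sums of `|c_k|²` grow by a factor at most `1 + A_{n+1}/(n+1)²`, and these factors are multiplied up.
The sharp inequality has no factor `2` in the exponent; any finite bound suffices here. -/
theorem sum_sq_norm_le_exp_of_recurrence {a c : ℕ → ℂ} (h0 : c 0 = 1)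
    (hc : ∀ n : ℕ, ((n : ℂ) + 1) * c (n + 1) =
      ∑ k ∈ Finset.range (n + 1), ((k : ℂ) + 1) * a (k + 1) * c (n - k)) (n : ℕ) :
    ∑ k ∈ Finset.range (n + 1), ‖c k‖ ^ 2 ≤
      Real.exp (2 * ∑ k ∈ Finset.range n, ((k : ℝ) + 1) * ‖a (k + 1)‖ ^ 2) := by
  set A : ℕ → ℝ := fun n => ∑ k ∈ Finset.range n, ((k : ℝ) + 1) ^ 2 * ‖a (k + 1)‖ ^ 2 with hA
  have hA0 : ∀ n, 0 ≤ A n := fun n => Finset.sum_nonneg fun k _ => by positivity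
  -- The correction `- A n / n` makes the induction close; at `n = 0` it is `0 / 0 = 0`.
  suffices H : ∑ k ∈ Finset.range (n + 1), ‖c k‖ ^ 2 ≤
      Real.exp (2 * ∑ k ∈ Finset.range n, ((k : ℝ) + 1) * ‖a (k + 1)‖ ^ 2 - A n / n) by
    refine H.trans (Real.exp_le_exp.2 ?_)
    have := hA0 n
    have : 0 ≤ A n / n := by positivity
    linarith
  induction n with
  | zero => simp [h0, hA]
  | succ n ih =>
    set S := ∑ k ∈ Finset.range (n + 1), ‖c k‖ ^ 2 with hS
    have hS0 : 0 ≤ S := Finset.sum_nonneg fun k _ => by positivity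
    have h1 : ((n : ℝ) + 1) ^ 2 * ‖c (n + 1)‖ ^ 2 ≤ A (n + 1) * S := by
      have e1 : ((n : ℝ) + 1) * ‖c (n + 1)‖ ≤
          ∑ k ∈ Finset.range (n + 1), (((k : ℝ) + 1) * ‖a (k + 1)‖) * ‖c (n - k)‖ := by
        have e2 : ((n : ℝ) + 1) * ‖c (n + 1)‖ = ‖((n : ℂ) + 1) * c (n + 1)‖ := by
          rw [norm_mul]; congr 1
          exact_mod_cast (Complex.norm_natCast (n + 1)).symm
        rw [e2, hc]
        refine (norm_sum_le _ _).trans (Finset.sum_le_sum fun k _ => ?_)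
        rw [norm_mul, norm_mul]
        gcongr
        exact_mod_cast (Complex.norm_natCast (k + 1)).le
      calc ((n : ℝ) + 1) ^ 2 * ‖c (n + 1)‖ ^ 2 = (((n : ℝ) + 1) * ‖c (n + 1)‖) ^ 2 := by ring
        _ ≤ (∑ k ∈ Finset.range (n + 1), (((k : ℝ) + 1) * ‖a (k + 1)‖) * ‖c (n - k)‖) ^ 2 := by
          gcongr
        _ ≤ (∑ k ∈ Finset.range (n + 1), (((k : ℝ) + 1) * ‖a (k + 1)‖) ^ 2) *
            ∑ k ∈ Finset.range (n + 1), ‖c (n - k)‖ ^ 2 := Finset.sum_mul_sq_le_sq_mul_sq _ _ _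
        _ = A (n + 1) * S := by
          rw [hA, hS, ← Finset.sum_range_reflect (fun k => ‖c k‖ ^ 2)]
          simp only [mul_pow, add_tsub_cancel_right]
    have h2 : ∑ k ∈ Finset.range (n + 1 + 1), ‖c k‖ ^ 2 ≤
        S * Real.exp (A (n + 1) / ((n : ℝ) + 1) ^ 2) := by
      rw [Finset.sum_range_succ]
      have e1 : ‖c (n + 1)‖ ^ 2 ≤ S * (A (n + 1) / ((n : ℝ) + 1) ^ 2) := by
        rw [← mul_div_assoc, le_div_iff₀ (by positivity)]
        linarith
      nlinarith [Real.add_one_le_exp (A (n + 1) / ((n : ℝ) + 1) ^ 2)]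
    refine h2.trans ((mul_le_mul_of_nonneg_right ih (Real.exp_pos _).le).trans ?_)
    rw [← Real.exp_add, Real.exp_le_exp, Finset.sum_range_succ]
    have h3 : A (n + 1) = A n + ((n : ℝ) + 1) ^ 2 * ‖a (n + 1)‖ ^ 2 := by
      rw [hA]; simp only [Finset.sum_range_succ]
    have h4 : A (n + 1) / ((n : ℝ) + 1) ^ 2 = A n / ((n : ℝ) + 1) ^ 2 + ‖a (n + 1)‖ ^ 2 := by
      rw [h3]; field_simp
    have h5 : A (n + 1) / ((n : ℝ) + 1) = A n / ((n : ℝ) + 1) +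
        ((n : ℝ) + 1) * ‖a (n + 1)‖ ^ 2 := by
      rw [h3]; field_simp
    -- The telescoping bound `1/(n+1)² ≤ 1/n - 1/(n+1)`; for `n = 0` all terms vanish because `A 0 =
    -- 0`.
    have h6 : A n / ((n : ℝ) + 1) ^ 2 + A n / ((n : ℝ) + 1) ≤ A n / n := by
      rcases Nat.eq_zero_or_pos n with rfl | hn
      · simp [hA]
      · have hn' : (0 : ℝ) < n := by exact_mod_cast hn
        have : 1 / ((n : ℝ) + 1) ^ 2 + 1 / ((n : ℝ) + 1) ≤ 1 / n := by
          rw [div_add_div _ _ (by positivity) (by positivity), div_le_div_iff₀ (by positivity) hn']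
          nlinarith [sq_nonneg (n : ℝ), mul_pos hn' hn']
        have := mul_le_mul_of_nonneg_left this (hA0 n)
        calc _ = A n * (1 / ((n : ℝ) + 1) ^ 2 + 1 / ((n : ℝ) + 1)) := by ring
          _ ≤ _ := this
          _ = _ := by ring
    push_cast
    rw [h4, h5]
    have h7 : ‖a (n + 1)‖ ^ 2 ≤ ((n : ℝ) + 1) * ‖a (n + 1)‖ ^ 2 :=
      le_mul_of_one_le_left (by positivity) (by linarith [(Nat.cast_nonneg n : (0 : ℝ) ≤ n)])
    linarith

theorem hasSum_fourierCoeff_exp_eval (P : ℂ[X]) (k : ℤ) :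
    HasSum (fun j : ℕ => if 0 ≤ k then (P ^ j).coeff k.toNat / (j.factorial : ℂ) else 0)
      (fourierCoeff (fun t : 𝕋 => Complex.exp (P.eval (fourier 1 t : ℂ))) k) := by
  obtain ⟨M, hM⟩ := (isCompact_range (continuous_eval_fourier P)).isBounded.exists_norm_le
  have hM' : ∀ t : 𝕋, ‖P.eval (fourier 1 t : ℂ)‖ ≤ M := fun t => hM _ ⟨t, rfl⟩
  have hc : ∀ j : ℕ, Continuous fun t : 𝕋 =>
      (fourier (-k) t : ℂ) • (P.eval (fourier 1 t : ℂ) ^ j / (j.factorial : ℂ)) := fun j =>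
    (map_continuous (fourier (-k))).smul (((continuous_eval_fourier P).pow j).div_const _)
  have key := hasSum_integral_of_summable_integral_norm (μ := haar)
    (F := fun (j : ℕ) (t : 𝕋) =>
      (fourier (-k) t : ℂ) • (P.eval (fourier 1 t : ℂ) ^ j / (j.factorial : ℂ)))
    (fun j => (hc j).memLp_circle.integrable one_le_two) ?_
  · convert key using 1
    · rfl
    · ext j
      have := fourierCoeff_eval (P ^ j) k
      simp only [eval_pow] at this
      have e := fourierCoeff.const_mul (T := 2 * Real.pi)
        (fun t => P.eval (fourier 1 t : ℂ) ^ j) (j.factorial : ℂ)⁻¹ k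
      rw [this] at e
      unfold fourierCoeff at e
      simp only [div_eq_inv_mul]
      rw [e]
      split_ifs <;> simp
    · unfold fourierCoeff
      refine integral_congr_ae (Filter.Eventually.of_forall fun t => ?_)
      simp only [smul_eq_mul]
      rw [tsum_mul_left, Complex.exp_eq_exp_ℂ, NormedSpace.exp_eq_tsum_div]
  · refine (Real.summable_pow_div_factorial M).of_nonneg_of_le
      (fun j => integral_nonneg fun t => norm_nonneg _) fun j => ?_
    calc _ ≤ ∫ _ : 𝕋, M ^ j / (j.factorial : ℝ) ∂haar := by
          refine integral_mono ((hc j).memLp_circle.integrable one_le_two).norm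
            (integrable_const _) fun t => ?_
          simp only
          rw [norm_smul, norm_fourier_apply, one_mul, norm_div, norm_pow, Complex.norm_natCast]
          gcongr
          exact hM' t
      _ = _ := by simp

/-- Coefficientwise form of `(exp P)' = P' exp P`, obtained termwise from `(P^{i+1})' = (i+1) P^i
P'`. -/
theorem fourierCoeff_exp_eval_recurrence (P : ℂ[X]) (n : ℕ) :
    ((n : ℂ) + 1) * fourierCoeff (fun t : 𝕋 => Complex.exp (P.eval (fourier 1 t : ℂ))) ↑(n + 1) =
      ∑ k ∈ Finset.range (n + 1), ((k : ℂ) + 1) * P.coeff (k + 1) *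
        fourierCoeff (fun t : 𝕋 => Complex.exp (P.eval (fourier 1 t : ℂ))) ↑(n - k) := by
  have h : ∀ m : ℕ, HasSum (fun j : ℕ => (P ^ j).coeff m / (j.factorial : ℂ))
      (fourierCoeff (fun t : 𝕋 => Complex.exp (P.eval (fourier 1 t : ℂ))) m) := fun m => by
    simpa using hasSum_fourierCoeff_exp_eval P m
  have h1 := ((hasSum_nat_add_iff' 1).2 (h (n + 1))).mul_left ((n : ℂ) + 1)
  simp only [Finset.range_one, Finset.sum_singleton, pow_zero, coeff_one, Nat.add_eq_zero_iff,
    one_ne_zero, and_false, if_false, zero_div, sub_zero] at h1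
  refine h1.unique ?_
  have h2 := hasSum_sum (s := Finset.range (n + 1))
    fun k _ => (h (n - k)).mul_left (((k : ℂ) + 1) * P.coeff (k + 1))
  convert h2 using 1
  · ext i
    have e1 : (P ^ (i + 1)).coeff (n + 1) * ((n : ℂ) + 1) = ((i : ℂ) + 1) *
        ∑ k ∈ Finset.range (n + 1), P.coeff (k + 1) * ((k : ℂ) + 1) * (P ^ i).coeff (n - k) := by
      rw [← coeff_derivative, derivative_pow, Nat.add_sub_cancel, mul_assoc, coeff_C_mul,
        mul_comm (P ^ i), coeff_mul, Finset.Nat.sum_antidiagonal_eq_sum_range_succ_mk]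
      simp [coeff_derivative]
    have e2 : ((i + 1).factorial : ℂ) = ((i : ℂ) + 1) * i.factorial := by
      rw [Nat.factorial_succ]; push_cast; ring
    have e3 : ((i : ℂ) + 1) ≠ 0 := by exact_mod_cast i.succ_ne_zero
    have e4 : (i.factorial : ℂ) ≠ 0 := by exact_mod_cast i.factorial_ne_zero
    have e5 : ∑ k ∈ Finset.range (n + 1), ((k : ℂ) + 1) * P.coeff (k + 1) *
        ((P ^ i).coeff (n - k) / (i.factorial : ℂ)) = (∑ k ∈ Finset.range (n + 1),
          P.coeff (k + 1) * ((k : ℂ) + 1) * (P ^ i).coeff (n - k)) / (i.factorial : ℂ) := by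
      rw [Finset.sum_div]
      exact Finset.sum_congr rfl fun k _ => by ring
    rw [e5, e2, mul_div_assoc', mul_comm ((n : ℂ) + 1), e1, mul_div_mul_left _ _ e3]

theorem fourierCoeff_exp_eval_of_neg (P : ℂ[X]) {k : ℤ} (hk : k < 0) :
    fourierCoeff (fun t : 𝕋 => Complex.exp (P.eval (fourier 1 t : ℂ))) k = 0 := by
  refine (hasSum_fourierCoeff_exp_eval P k).unique ?_
  simp only [if_neg hk.not_ge]
  exact hasSum_zero

theorem fourierCoeff_exp_eval_zero (P : ℂ[X]) (hP : P.coeff 0 = 0) :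
    fourierCoeff (fun t : 𝕋 => Complex.exp (P.eval (fourier 1 t : ℂ))) 0 = 1 := by
  refine (hasSum_fourierCoeff_exp_eval P 0).unique ?_
  convert hasSum_single 0 fun j hj => ?_ using 1
  · simp
  · simp only [le_refl, if_true, Int.toNat_zero, coeff_zero_eq_eval_zero, eval_pow]
    rw [← coeff_zero_eq_eval_zero, hP, zero_pow hj, zero_div]

theorem integral_sq_norm_exp_eval_le (P : ℂ[X]) (hP : P.coeff 0 = 0) {B : ℝ}
    (hB : ∀ n : ℕ, ∑ k ∈ Finset.range n, ((k : ℝ) + 1) * ‖P.coeff (k + 1)‖ ^ 2 ≤ B) :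
    ∫ t : 𝕋, ‖Complex.exp (P.eval (fourier 1 t : ℂ))‖ ^ 2 ∂haar ≤ Real.exp (2 * B) := by
  have hc : Continuous fun t : 𝕋 => Complex.exp (P.eval (fourier 1 t : ℂ)) :=
    Complex.continuous_exp.comp (continuous_eval_fourier P)
  have h1 := hasSum_sq_fourierCoeff_of_memLp hc.memLp_circle
  rw [← Nat.cast_injective.hasSum_iff fun k hk => ?_] at h1
  · refine le_of_tendsto h1.tendsto_sum_nat (Filter.Eventually.of_forall fun n => ?_)
    have h2 := sum_sq_norm_le_exp_of_recurrence (a := P.coeff) (c := fun n : ℕ =>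
      fourierCoeff (fun t : 𝕋 => Complex.exp (P.eval (fourier 1 t : ℂ))) n)
      (by exact_mod_cast fourierCoeff_exp_eval_zero P hP)
      (fun n => fourierCoeff_exp_eval_recurrence P n) n
    refine le_trans ?_ (h2.trans (Real.exp_le_exp.2 (by linarith [hB n])))
    rw [Finset.sum_range_succ]
    exact le_add_of_nonneg_right (by positivity)
  · rw [fourierCoeff_exp_eval_of_neg, norm_zero, zero_pow two_ne_zero]
    by_contra h
    exact hk ⟨k.toNat, by simpa using h⟩

/-- Mean value inequality: on the segment from `b` to `a` the real part, hence `|exp|`, is largest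
at an endpoint. -/
theorem Complex.norm_exp_sub_exp_le (a b : ℂ) :
    ‖Complex.exp a - Complex.exp b‖ ≤ max ‖Complex.exp a‖ ‖Complex.exp b‖ * ‖a - b‖ := by
  refine Convex.norm_image_sub_le_of_norm_hasDerivWithin_le (f := Complex.exp) (f' := Complex.exp)
    (s := segment ℝ b a) (fun x _ => (Complex.hasDerivAt_exp x).hasDerivWithinAt) (fun x hx => ?_)
    (convex_segment b a) (left_mem_segment ℝ b a) (right_mem_segment ℝ b a)
  rw [Complex.norm_exp, Complex.norm_exp, Complex.norm_exp, ← Real.exp_monotone.map_max]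
  obtain ⟨u, v, hu, hv, huv, rfl⟩ := hx
  refine Real.exp_le_exp.2 ?_
  simp only [Complex.add_re, Complex.real_smul, Complex.mul_re, Complex.ofReal_re,
    Complex.ofReal_im, zero_mul, sub_zero]
  have h1 := mul_le_mul_of_nonneg_left (le_max_right a.re b.re) hu
  have h2 := mul_le_mul_of_nonneg_left (le_max_left a.re b.re) hv
  have h3 : max a.re b.re = u * max a.re b.re + v * max a.re b.re := by
    rw [← add_mul, huv, one_mul]
  linarith

open Filter Topology in
/-- An analytic function in `L²` is the limit of the partial sums of its Fourier series. -/
theorem exists_polynomial_tendsto {F : 𝕋 → ℂ} (hF : MemLp F 2 haar)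
    (hneg : ∀ k < 0, fourierCoeff F k = 0) :
    ∃ P : ℕ → ℂ[X], (∀ N k, (P N).coeff k = if k < N then fourierCoeff F k else 0) ∧
      Tendsto (fun N => eLpNorm ((fun t => (P N).eval (fourier 1 t : ℂ)) - F) 2 haar)
        atTop (𝓝 0) := by
  refine ⟨fun N => ∑ k ∈ Finset.range N, monomial k (fourierCoeff F k), fun N k => ?_, ?_⟩
  · simp [coeff_monomial]
  · have h1 := hasSum_fourier_series_L2 (hF.toLp F)
    rw [fourierCoeff_toLp_eq, ← Nat.cast_injective.hasSum_iff fun k hk => ?_] at h1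
    · have h2 := h1.tendsto_sum_nat
      rw [Lp.tendsto_Lp_iff_tendsto_eLpNorm] at h2
      refine h2.congr fun N => eLpNorm_congr_ae ?_
      have h3 : ∑ i ∈ Finset.range N, ((fun i : ℤ => fourierCoeff F i • fourierLp 2 i) ∘
          Nat.cast) i = ContinuousMap.toLp (E := ℂ) 2 haar ℂ
            (∑ i ∈ Finset.range N, fourierCoeff F (i : ℤ) • fourier (i : ℤ)) := by
        simp only [map_sum, map_smul, Function.comp_apply]
      rw [h3]
      filter_upwards [ContinuousMap.coeFn_toLp haar (𝕜 := ℂ) (p := 2)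
        (∑ i ∈ Finset.range N, fourierCoeff F (i : ℤ) • fourier (i : ℤ))] with t ht
      rw [Pi.sub_apply, Pi.sub_apply, ht, eval_finsetSum, ContinuousMap.sum_apply]
      congr 1
      refine Finset.sum_congr rfl fun i _ => ?_
      rw [eval_monomial, fourier_one_pow, ContinuousMap.smul_apply, smul_eq_mul]
    · rw [hneg, zero_smul]
      by_contra h
      exact hk ⟨k.toNat, by simpa using h⟩

open Filter Topology ENNReal in
/-- The exponential of an analytic function of mean zero in `H^{1/2}` lies in the Hardy space. -/
theorem memLp_exp_of_analytic {F : 𝕋 → ℂ} (hF : MemLp F 2 haar)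
    (hneg : ∀ k ≤ 0, fourierCoeff F k = 0)
    (hs : Summable fun k : ℕ => (k : ℝ) * ‖fourierCoeff F k‖ ^ 2) :
    MemLp (fun t => Complex.exp (F t)) 2 haar ∧
      (∀ k < 0, fourierCoeff (fun t => Complex.exp (F t)) k = 0) ∧
      fourierCoeff (fun t => Complex.exp (F t)) 0 = 1 := by
  obtain ⟨P, hP, hlim⟩ := exists_polynomial_tendsto hF fun k hk => hneg k hk.le
  set B := ∑' k : ℕ, (k : ℝ) * ‖fourierCoeff F k‖ ^ 2
  have hP0 : ∀ N, (P N).coeff 0 = 0 := fun N => by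
    rw [hP]; split_ifs
    · exact_mod_cast hneg 0 le_rfl
    · rfl
  have hc : ∀ N, Continuous fun t : 𝕋 => Complex.exp ((P N).eval (fourier 1 t : ℂ)) := fun N =>
    Complex.continuous_exp.comp (continuous_eval_fourier (P N))
  have hbound : ∀ N, eLpNorm (fun t : 𝕋 => Complex.exp ((P N).eval (fourier 1 t : ℂ))) 2 haar ≤
      ENNReal.ofReal (Real.exp B) := fun N => by
    have h1 := integral_sq_norm_exp_eval_le (P N) (hP0 N) (B := B) fun n => by
      refine le_trans ?_ (hs.sum_le_tsum (Finset.range (n + 1)) fun k _ => by positivity)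
      rw [Finset.sum_range_succ']
      simp only [Nat.cast_zero, zero_mul, add_zero]
      refine Finset.sum_le_sum fun k _ => ?_
      rw [hP]
      split_ifs
      · push_cast; rfl
      · simp; positivity
    rw [(hc N).memLp_circle.eLpNorm_eq_integral_rpow_norm two_ne_zero ofNat_ne_top]
    refine ENNReal.ofReal_le_ofReal ?_
    simp only [toReal_ofNat, Real.rpow_ofNat]
    calc _ ≤ (Real.exp (2 * B)) ^ ((2 : ℝ)⁻¹) := by gcongr
      _ = Real.exp B := by rw [← Real.exp_mul]; congr 1; ring
  have hmeas : AEStronglyMeasurable (fun t => Complex.exp (F t)) haar :=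
    Complex.continuous_exp.comp_aestronglyMeasurable hF.1
  -- Fatou's lemma along a subsequence of the partial sums that converges almost everywhere.
  have hexp : eLpNorm (fun t => Complex.exp (F t)) 2 haar ≤ ENNReal.ofReal (Real.exp B) := by
    obtain ⟨ns, -, hns⟩ := (tendstoInMeasure_of_tendsto_eLpNorm two_ne_zero
      (fun N => (continuous_eval_fourier (P N)).aestronglyMeasurable) hF.1
      hlim).exists_seq_tendsto_ae
    refine (Lp.eLpNorm_lim_le_liminf_eLpNorm (fun n => (hc (ns n)).aestronglyMeasurable) _
      ?_).trans (liminf_le_of_le (by isBoundedDefault) fun b hb => ?_)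
    · filter_upwards [hns] with t ht
      exact (Complex.continuous_exp.tendsto _).comp ht
    · obtain ⟨n, hn⟩ := hb.exists
      exact hn.trans (hbound _)
  have hmem : MemLp (fun t => Complex.exp (F t)) 2 haar := ⟨hmeas, hexp.trans_lt ofReal_lt_top⟩
  -- By `|e^a - e^b| ≤ (|e^a| + |e^b|) |a - b|` and Hölder, the uniform `L²` bound gives convergence
  -- in `L¹`, which is enough to pass to the limit in Fourier coefficients.
  have hL1 : Tendsto (fun N => eLpNorm ((fun t : 𝕋 => Complex.exp ((P N).eval (fourier 1 t : ℂ))) -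
      fun t => Complex.exp (F t)) 1 haar) atTop (𝓝 0) := by
    set C := ENNReal.ofReal (Real.exp B) + ENNReal.ofReal (Real.exp B)
    have hC : C ≠ ∞ := by simp [C]
    have hlim' := ENNReal.Tendsto.const_mul hlim (Or.inr hC)
    rw [mul_zero] at hlim'
    refine tendsto_of_tendsto_of_tendsto_of_le_of_le tendsto_const_nhds hlim'
      (fun N => bot_le) fun N => ?_
    have h2 : eLpNorm ((fun t : 𝕋 => ‖Complex.exp ((P N).eval (fourier 1 t : ℂ))‖) +
        fun t => ‖Complex.exp (F t)‖) 2 haar ≤ C := by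
      refine (eLpNorm_add_le (hc N).norm.aestronglyMeasurable hmeas.norm one_le_two).trans ?_
      rw [eLpNorm_norm, eLpNorm_norm]
      exact add_le_add (hbound N) hexp
    have h3 : AEStronglyMeasurable ((fun t => (P N).eval (fourier 1 t : ℂ)) - F) haar :=
      (continuous_eval_fourier (P N)).aestronglyMeasurable.sub hF.1
    refine le_trans ?_ ((eLpNorm_smul_le_mul_eLpNorm (p := 2) (q := 2) (r := 1) h3
      ((hc N).norm.aestronglyMeasurable.add hmeas.norm)).trans (mul_le_mul_left h2 _))
    refine eLpNorm_mono fun t => ?_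
    simp only [Pi.sub_apply, Pi.smul_apply', Pi.add_apply, norm_smul]
    refine (Complex.norm_exp_sub_exp_le _ _).trans ?_
    rw [Real.norm_of_nonneg (add_nonneg (norm_nonneg _) (norm_nonneg _))]
    exact mul_le_mul_of_nonneg_right
      (max_le_add_of_nonneg (norm_nonneg _) (norm_nonneg _)) (norm_nonneg _)
  have hcoef : ∀ k, Tendsto (fun N => fourierCoeff
      (fun t : 𝕋 => Complex.exp ((P N).eval (fourier 1 t : ℂ))) k) atTop
      (𝓝 (fourierCoeff (fun t => Complex.exp (F t)) k)) := fun k => by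
    refine tendsto_integral_of_L1' _ ((hmem.integrable one_le_two).fourier_smul _).1
      (Eventually.of_forall fun N =>
        ((hc N).memLp_circle.integrable one_le_two).fourier_smul _) ?_
    refine hL1.congr fun N => eLpNorm_congr_norm_ae (Eventually.of_forall fun t => ?_)
    simp only [Pi.sub_apply]
    rw [← smul_sub, norm_smul, norm_fourier_apply, one_mul]
  refine ⟨hmem, fun k hk => tendsto_nhds_unique (hcoef k) ?_, tendsto_nhds_unique (hcoef 0) ?_⟩
  · simp only [fourierCoeff_exp_eval_of_neg _ hk]
    exact tendsto_const_nhds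
  · simp only [fun N => fourierCoeff_exp_eval_zero (P N) (hP0 N)]
    exact tendsto_const_nhds

/-! ### Douglas' formula and Lipschitz functions of functions in `H^{1/2}` -/

section

open ENNReal

theorem lintegral_enorm_sq_eq_tsum {g : 𝕋 → ℂ} (hg : MemLp g 2 haar) :
    ∫⁻ t, ‖g t‖ₑ ^ 2 ∂haar = ∑' k : ℤ, ‖fourierCoeff g k‖ₑ ^ 2 := by
  have h := hasSum_sq_fourierCoeff_of_memLp hg
  have h1 : ∀ z : ℂ, ‖z‖ₑ ^ 2 = ENNReal.ofReal (‖z‖ ^ 2) := fun z => by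
    rw [ENNReal.ofReal_pow (norm_nonneg _), ofReal_norm]
  simp only [h1]
  rw [← ofReal_integral_eq_lintegral_ofReal hg.norm.integrable_sq
    (Filter.Eventually.of_forall fun t => by positivity), ← h.tsum_eq,
    ENNReal.ofReal_tsum_of_nonneg (fun k => by positivity) h.summable]

theorem fourierCoeff_comp_add_right (g : 𝕋 → ℂ) (h : 𝕋) (k : ℤ) :
    fourierCoeff (fun t => g (t + h)) k = fourier k h * fourierCoeff g k := by
  unfold fourierCoeff
  rw [← integral_const_mul]
  rw [← integral_add_right_eq_self (fun t => (fourier k h : ℂ) * (fourier (-k) t • g t)) h]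
  congr 1; ext t
  have e1 : (fourier (-k) (t + h) : ℂ) = fourier (-k) t * fourier (-k) h := by
    simp only [fourier_apply, smul_add, toCircle_add, Circle.coe_mul]
  have e2 : (fourier k h : ℂ) * fourier (-k) h = 1 := by
    rw [← fourier_add, add_neg_cancel, fourier_zero]
  have : (fourier k h : ℂ) * fourier (-k) (t + h) = fourier (-k) t := by
    rw [e1, mul_left_comm, e2, mul_one]
  rw [smul_eq_mul, smul_eq_mul, ← mul_assoc, this]

theorem MeasureTheory.MemLp.comp_add_right {g : 𝕋 → ℂ} (hg : MemLp g 2 haar) (h : 𝕋) :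
    MemLp (fun t => g (t + h)) 2 haar :=
  hg.comp_measurePreserving (measurePreserving_add_right haar h)

theorem lintegral_enorm_sub_sq {g : 𝕋 → ℂ} (hg : MemLp g 2 haar) (h : 𝕋) :
    ∫⁻ t, ‖g (t + h) - g t‖ₑ ^ 2 ∂haar =
      ∑' k : ℤ, ‖(fourier k h : ℂ) - 1‖ₑ ^ 2 * ‖fourierCoeff g k‖ₑ ^ 2 := by
  have h1 := lintegral_enorm_sq_eq_tsum ((hg.comp_add_right h).sub hg)
  simp only [Pi.sub_apply] at h1
  rw [h1]
  refine tsum_congr fun k => ?_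
  rw [← mul_pow, ← enorm_mul]
  congr 2
  have := congrFun (fourierCoeff.add ((hg.comp_add_right h).integrable one_le_two)
    (hg.neg.integrable one_le_two)) k
  rw [← sub_eq_add_neg, Pi.add_apply, fourierCoeff_comp_add_right] at this
  rw [this, sub_mul, one_mul, sub_eq_add_neg]
  congr 1
  have := fourierCoeff.const_mul g (-1) k
  rw [neg_one_mul] at this
  rw [← this]
  congr 1; ext t; simp

/-- The quotient is `|1 + z + ⋯ + z^{|k|-1}|²` away from `z = 1`, and Parseval counts its `|k|`
coefficients. -/
theorem lintegral_enorm_fourier_sub_one_sq_div (k : ℤ) :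
    ∫⁻ h : 𝕋, ‖(fourier k h : ℂ) - 1‖ₑ ^ 2 / ‖(fourier 1 h : ℂ) - 1‖ₑ ^ 2 ∂haar =
      (k.natAbs : ℝ≥0∞) := by
  set P : ℂ[X] := ∑ j ∈ Finset.range k.natAbs, X ^ j with hP
  have hcoeff : ∀ j, P.coeff j = if j < k.natAbs then 1 else 0 := fun j => by
    simp [hP, coeff_X_pow]
  have h1 : ∫⁻ h : 𝕋, ‖P.eval (fourier 1 h : ℂ)‖ₑ ^ 2 ∂haar = (k.natAbs : ℝ≥0∞) := by
    rw [lintegral_enorm_sq_eq_tsum (continuous_eval_fourier P).memLp_circle,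
      ← Nat.cast_injective.tsum_eq, tsum_eq_sum (s := Finset.range k.natAbs)]
    · rw [Finset.sum_congr rfl (g := fun _ => 1)]
      · simp
      · intro j hj
        rw [fourierCoeff_eval]
        simp [hcoeff, Finset.mem_range.1 hj]
    · intro j hj
      rw [Finset.mem_range] at hj
      rw [fourierCoeff_eval]
      simp [hcoeff, hj]
    · intro j hj
      rw [Function.mem_support, fourierCoeff_eval] at hj
      by_contra h
      refine hj ?_
      rw [if_neg]
      · simp
      · intro h0
        exact h ⟨j.toNat, by simpa using h0⟩
  rw [← h1]
  refine lintegral_congr_ae ?_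
  have h0 : ∀ᵐ h : 𝕋 ∂haar, h ≠ 0 := by
    have h2 := AddCircle.volume_closedBall (2 * Real.pi) (x := 0) 0
    rw [Metric.closedBall_zero, volume_eq_smul_haarAddCircle, mul_zero,
      min_eq_right Real.two_pi_pos.le, ENNReal.ofReal_zero, Measure.smul_apply, smul_eq_mul,
      mul_eq_zero] at h2
    rw [ae_iff]
    simpa [Real.pi_pos.not_ge] using h2
  filter_upwards [h0] with h hh
  have hne : (fourier 1 h : ℂ) - 1 ≠ 0 := by
    intro e
    rw [sub_eq_zero, fourier_one] at e
    refine hh (injective_toCircle (T := 2 * Real.pi) (by positivity) (Circle.ext ?_))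
    rw [e, toCircle_zero, Circle.coe_one]
  have hnorm : ‖(fourier k h : ℂ) - 1‖ₑ = ‖(fourier 1 h : ℂ) ^ k.natAbs - 1‖ₑ := by
    rw [fourier_one_pow]
    rcases Int.natAbs_eq k with hk | hk
    · rw [← hk]
    · conv_lhs => rw [hk, fourier_neg]
      rw [← ofReal_norm, ← ofReal_norm, ← RCLike.norm_conj]
      simp
  rw [hnorm, ← geom_sum_mul, enorm_mul, mul_pow, ENNReal.mul_div_cancel_right]
  · rw [hP]; simp [eval_finsetSum]
  · simpa using hne
  · simp

/-- Parseval in `t` followed by Tonelli in `h`. With values in `[0, ∞]` no summability is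
presupposed, so the formula can be used to prove membership in `H^{1/2}`. -/
theorem lintegral_douglas {g : 𝕋 → ℂ} (hg : MemLp g 2 haar) :
    ∫⁻ h, (∫⁻ t, ‖g (t + h) - g t‖ₑ ^ 2 ∂haar) / ‖(fourier 1 h : ℂ) - 1‖ₑ ^ 2 ∂haar =
      ∑' k : ℤ, ENNReal.ofReal (|(k : ℝ)| * ‖fourierCoeff g k‖ ^ 2) := by
  have h1 : ∀ h : 𝕋, (∫⁻ t, ‖g (t + h) - g t‖ₑ ^ 2 ∂haar) / ‖(fourier 1 h : ℂ) - 1‖ₑ ^ 2 =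
      ∑' k : ℤ, ‖(fourier k h : ℂ) - 1‖ₑ ^ 2 / ‖(fourier 1 h : ℂ) - 1‖ₑ ^ 2 *
        ‖fourierCoeff g k‖ₑ ^ 2 := fun h => by
    rw [lintegral_enorm_sub_sq hg, div_eq_mul_inv, ← ENNReal.tsum_mul_right]
    exact tsum_congr fun k => by rw [div_eq_mul_inv, mul_right_comm]
  have hm : ∀ k : ℤ, Measurable fun h : 𝕋 => ‖(fourier k h : ℂ) - 1‖ₑ ^ 2 := fun k =>
    (((map_continuous (fourier k)).sub continuous_const).measurable.enorm).pow_const 2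
  have hd : ∀ k : ℤ, Measurable fun h : 𝕋 =>
      ‖(fourier k h : ℂ) - 1‖ₑ ^ 2 / ‖(fourier 1 h : ℂ) - 1‖ₑ ^ 2 := fun k => (hm k).div (hm 1)
  simp only [h1]
  rw [lintegral_tsum fun k => ((hd k).mul_const _).aemeasurable]
  refine tsum_congr fun k => ?_
  rw [lintegral_mul_const _ (hd k), lintegral_enorm_fourier_sub_one_sq_div,
    ENNReal.ofReal_mul (abs_nonneg _), ENNReal.ofReal_pow (norm_nonneg _), ofReal_norm,
    ← Int.cast_abs, Int.abs_eq_natAbs, Int.cast_natCast, ENNReal.ofReal_natCast]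

theorem MemHHalf.of_norm_sub_le {g u : 𝕋 → ℂ} (hg : MemHHalf g) (hu : MemLp u 2 haar)
    (h : ∀ s, ∀ᵐ t ∂haar, ‖u (t + s) - u t‖ ≤ ‖g (t + s) - g t‖) : MemHHalf u := by
  refine ⟨hu, ?_⟩
  have h1 : ∑' k : ℤ, ENNReal.ofReal (|(k : ℝ)| * ‖fourierCoeff u k‖ ^ 2) ≠ ∞ := by
    refine ne_top_of_le_ne_top (b := ∑' k : ℤ,
      ENNReal.ofReal (|(k : ℝ)| * ‖fourierCoeff g k‖ ^ 2)) ?_ ?_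
    · rw [← ENNReal.ofReal_tsum_of_nonneg (fun k => by positivity) hg.2]
      exact ofReal_ne_top
    · rw [← lintegral_douglas hu, ← lintegral_douglas hg.1]
      refine lintegral_mono fun s => ENNReal.div_le_div_right (lintegral_mono_ae ?_) _
      filter_upwards [h s] with t ht
      gcongr
      rw [← ofReal_norm, ← ofReal_norm]
      exact ENNReal.ofReal_le_ofReal ht
  have h2 := ENNReal.summable_toReal h1
  refine h2.congr fun k => ?_
  rw [ENNReal.toReal_ofReal (by positivity)]

theorem MemHHalf.exp {g : 𝕋 → ℂ} (hg : MemHHalf g) (hre : ∀ᵐ t ∂haar, (g t).re = 0) :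
    MemHHalf fun t => Complex.exp (g t) := by
  have hn : ∀ t, (g t).re = 0 → ‖Complex.exp (g t)‖ = 1 := fun t ht => by
    rw [Complex.norm_exp, ht, Real.exp_zero]
  refine hg.of_norm_sub_le ?_ fun s => ?_
  · refine MemLp.of_bound (Complex.continuous_exp.comp_aestronglyMeasurable hg.1.1) 1 ?_
    filter_upwards [hre] with t ht using (hn t ht).le
  · filter_upwards [hre, (measurePreserving_add_right haar s).quasiMeasurePreserving.ae hre]
      with t h1 h2
    refine (Complex.norm_exp_sub_exp_le _ _).trans ?_
    rw [hn t h1, hn (t + s) h2, max_self, one_mul]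

end

/-! ### Tail sums -/

/-- There are `m + 1` pairs `(i, j)` with `i + j = m`. This is how the weight `m + 1` arises from
the Hilbert–Schmidt norm of a Hankel matrix. -/
theorem hasSum_tsum_nat_add {u : ℕ → ℝ} (hu : ∀ m, 0 ≤ u m)
    (hs : Summable fun m : ℕ => ((m : ℝ) + 1) * u m) :
    HasSum (fun i => ∑' j, u (i + j)) (∑' m : ℕ, ((m : ℝ) + 1) * u m) := by
  have h1 : Summable fun x : Σ n : ℕ, Finset.HasAntidiagonal.antidiagonal n =>
      u ((x.2 : ℕ × ℕ).1 + (x.2 : ℕ × ℕ).2) := by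
    rw [summable_sigma_of_nonneg fun _ => hu _]
    refine ⟨fun n => (hasSum_fintype _).summable, hs.congr fun n => ?_⟩
    rw [tsum_fintype, Finset.sum_congr rfl (g := fun _ => u n)]
    · simp
    · intro x _
      rw [Finset.HasAntidiagonal.mem_antidiagonal.1 x.2]
  have h2 : HasSum (fun x : Σ n : ℕ, Finset.HasAntidiagonal.antidiagonal n =>
      u ((x.2 : ℕ × ℕ).1 + (x.2 : ℕ × ℕ).2)) (∑' m : ℕ, ((m : ℝ) + 1) * u m) := by
    have h3 := h1.hasSum.sigma fun n => hasSum_fintype _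
    convert h1.hasSum using 1
    rw [← h3.tsum_eq]
    refine tsum_congr fun n => ?_
    rw [Finset.sum_congr rfl (g := fun _ => u n)]
    · simp
    · intro x _
      rw [Finset.HasAntidiagonal.mem_antidiagonal.1 x.2]
  have h3 : HasSum (fun p : ℕ × ℕ => u (p.1 + p.2)) (∑' m : ℕ, ((m : ℝ) + 1) * u m) :=
    (Finset.HasAntidiagonal.sigmaAntidiagonalEquivProd (A := ℕ)).hasSum_iff.1 h2
  exact h3.prod_fiberwise fun i => (h3.summable.prod_factor i).hasSum

/-! ### A contraction argument in Hilbert space -/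

/-- Eliminating `Y` gives `(1 - T T') X = e`, solved by a Neumann series since `‖T T'‖ ≤ ρ²`.
Applying `T'` gives `T' X = T' e + T' T (T' X)`, so the bound on `Y` involves only `‖T' e‖`, which
is small, and not `‖e‖`. -/
theorem exists_sub_apply_eq {H : Type*} [NormedAddCommGroup H] [InnerProductSpace ℂ H]
    [CompleteSpace H] (T T' : H →L[ℂ] H) (hadj : ∀ a b, inner ℂ (T a) b = inner ℂ a (T' b))
    {ρ : ℝ} (hρ0 : 0 ≤ ρ) (hρ1 : ρ < 1) (hT : ∀ a, ‖T a‖ ≤ ρ * ‖a‖) (e : H) :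
    ∃ X Y : H, X = e - T Y ∧ Y = -T' X ∧ (1 - ρ ^ 2) * ‖Y‖ ≤ ‖T' e‖ := by
  have hT' : ∀ b, ‖T' b‖ ≤ ρ * ‖b‖ := fun b => by
    rcases (norm_nonneg (T' b)).eq_or_lt with h | h
    · rw [← h]; positivity
    · have h1 : ‖T' b‖ ^ 2 ≤ ‖T (T' b)‖ * ‖b‖ := by
        rw [← inner_self_eq_norm_sq (𝕜 := ℂ), ← hadj]
        exact (RCLike.re_le_norm _).trans (norm_inner_le_norm _ _)
      nlinarith [mul_le_mul_of_nonneg_right (hT (T' b)) (norm_nonneg b)]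
  have hn : ‖T * T'‖ < 1 := by
    refine ((T * T').opNorm_le_bound (M := ρ * ρ) (by positivity) fun x => ?_).trans_lt
      (by nlinarith)
    rw [mul_apply_eq_comp, mul_assoc]
    exact (hT _).trans (mul_le_mul_of_nonneg_left (hT' x) hρ0)
  obtain ⟨u, hu⟩ := isUnit_one_sub_of_norm_lt_one hn
  set X := (↑u⁻¹ : H →L[ℂ] H) e with hX
  have hX1 : X - T (T' X) = e := by
    have h1 : ((1 : H →L[ℂ] H) - T * T') X = e := by
      rw [← hu, hX, ← mul_apply_eq_comp, Units.mul_inv, one_apply_eq_self]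
    simpa using h1
  refine ⟨X, -T' X, ?_, rfl, ?_⟩
  · rw [map_neg, sub_neg_eq_add, ← hX1, sub_add_cancel]
  · rw [norm_neg]
    have h1 : T' X = T' e + T' (T (T' X)) := by
      conv_lhs => rw [← sub_add_cancel X (T (T' X)), map_add, hX1]
    have h2 : ‖T' X‖ ≤ ‖T' e‖ + ρ * (ρ * ‖T' X‖) := by
      conv_lhs => rw [h1]
      exact (norm_add_le _ _).trans (add_le_add le_rfl
        ((hT' _).trans (mul_le_mul_of_nonneg_left (hT _) hρ0)))
    nlinarith

/-! ### Projections onto sets of frequencies and multiplication operators -/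

local notation "L2" => Lp ℂ 2 (haarAddCircle : Measure (AddCircle (2 * Real.pi)))

/-- The subspace of `L²` of the functions with frequencies in `S`. -/
def freqSubspace (S : Set ℤ) : Submodule ℂ L2 where
  carrier := {g | ∀ k ∉ S, fourierBasis.repr g k = 0}
  add_mem' ha hb k hk := by rw [map_add, lp.coeFn_add, Pi.add_apply, ha k hk, hb k hk, add_zero]
  zero_mem' k _ := by simp
  smul_mem' c g hg k hk := by rw [map_smul, lp.coeFn_smul, Pi.smul_apply, hg k hk, smul_zero]

theorem mem_freqSubspace {S : Set ℤ} {g : L2} :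
    g ∈ freqSubspace S ↔ ∀ k ∉ S, fourierBasis.repr g k = 0 := Iff.rfl

theorem isClosed_freqSubspace (S : Set ℤ) : IsClosed (freqSubspace S : Set L2) := by
  have : (freqSubspace S : Set L2) =
      ⋂ k ∈ Sᶜ, {g : L2 | inner ℂ (fourierBasis k) g = 0} := by
    ext g
    simp [mem_freqSubspace, fourierBasis.repr_apply_apply]
  rw [this]
  exact isClosed_biInter fun k _ => isClosed_eq (by fun_prop) continuous_const

instance (S : Set ℤ) : CompleteSpace (freqSubspace S) :=
  (isClosed_freqSubspace S).completeSpace_coe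

theorem fourierBasis_repr_basis (j k : ℤ) :
    fourierBasis.repr (fourierBasis j : L2) k = if j = k then 1 else 0 := by
  rw [fourierBasis.repr_self, lp.single_apply, Pi.single_apply]
  simp [eq_comm]

/-- The orthogonal projection of `L²` onto the functions with frequencies in `S`. -/
def freqProj (S : Set ℤ) : L2 →L[ℂ] L2 := (freqSubspace S).starProjection

theorem freqProj_mem (S : Set ℤ) (g : L2) : freqProj S g ∈ freqSubspace S :=
  Submodule.starProjection_apply_mem _ _

theorem fourierBasis_repr_freqProj_of_mem {S : Set ℤ} (g : L2) {k : ℤ} (hk : k ∈ S) :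
    fourierBasis.repr (freqProj S g) k = fourierBasis.repr g k := by
  have h1 : (fourierBasis k : L2) ∈ freqSubspace S := fun j hj => by
    rw [fourierBasis_repr_basis, if_neg]
    rintro rfl
    exact hj hk
  have h2 := Submodule.starProjection_inner_eq_zero g _ h1
  rw [fourierBasis.repr_apply_apply, fourierBasis.repr_apply_apply, ← sub_eq_zero, ← inner_sub_right,
    ← neg_sub, inner_neg_right, ← inner_conj_symm]
  rw [freqProj, h2, map_zero, neg_zero]

theorem inner_freqProj_left (S : Set ℤ) (a b : L2) :
    inner ℂ (freqProj S a) b = inner ℂ a (freqProj S b) :=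
  Submodule.inner_starProjection_left_eq_right _ _ _

theorem freqProj_eq_self {S : Set ℤ} {g : L2} (hg : g ∈ freqSubspace S) : freqProj S g = g :=
  Submodule.starProjection_eq_self_iff.2 hg

theorem hasSum_norm_sq_repr (g : L2) : HasSum (fun k => ‖fourierBasis.repr g k‖ ^ 2) (‖g‖ ^ 2) := by
  have := lp.hasSum_norm (p := 2) (by simp) (fourierBasis.repr g)
  simpa using this

/-- A function in `L²` with frequencies in the range of `φ` has norm `(∑ |g_{φ i}|²)^{1/2}`. -/
theorem hasSum_norm_sq_repr_comp {φ : ℕ → ℤ} (hφ : Function.Injective φ) {g : L2}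
    (hg : g ∈ freqSubspace (Set.range φ)) :
    HasSum (fun i => ‖fourierBasis.repr g (φ i)‖ ^ 2) (‖g‖ ^ 2) := by
  refine (hφ.hasSum_iff fun k hk => ?_).2 (hasSum_norm_sq_repr g)
  rw [hg k hk, norm_zero, zero_pow two_ne_zero]

theorem MeasureTheory.MemLp.unimodular_mul {a g : 𝕋 → ℂ} (ha : AEStronglyMeasurable a haar)
    (ha1 : ∀ᵐ t ∂haar, ‖a t‖ = 1) (hg : MemLp g 2 haar) :
    MemLp (fun t => a t * g t) 2 haar := by
  refine hg.of_le (ha.mul hg.1) ?_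
  filter_upwards [ha1] with t ht
  rw [norm_mul, ht, one_mul]

/-- Multiplication by a unimodular function as an operator in `L²`. -/
theorem exists_mulOp {a : 𝕋 → ℂ} (ha : AEStronglyMeasurable a haar)
    (ha1 : ∀ᵐ t ∂haar, ‖a t‖ = 1) :
    ∃ M : L2 →L[ℂ] L2, (∀ g, ‖M g‖ ≤ ‖g‖) ∧ ∀ g, M g =ᵐ[haar] fun t => a t * g t := by
  have hm : ∀ g : L2, MemLp (fun t => a t * g t) 2 haar := fun g =>
    MemLp.unimodular_mul ha ha1 (Lp.memLp g)
  let L : L2 →ₗ[ℂ] L2 :=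
    { toFun := fun g => (hm g).toLp
      map_add' := fun g h => by
        rw [← MemLp.toLp_add]
        refine MemLp.toLp_congr _ _ ?_
        filter_upwards [Lp.coeFn_add g h] with t ht
        rw [ht, Pi.add_apply, Pi.add_apply, mul_add]
      map_smul' := fun c g => by
        rw [RingHom.id_apply, ← MemLp.toLp_const_smul]
        refine MemLp.toLp_congr _ _ ?_
        filter_upwards [Lp.coeFn_smul c g] with t ht
        rw [ht, Pi.smul_apply, Pi.smul_apply, mul_smul_comm] }
  have hL : ∀ g, ‖L g‖ ≤ 1 * ‖g‖ := fun g => by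
    rw [one_mul]
    refine Lp.norm_le_norm_of_ae_le ?_
    filter_upwards [(hm g).coeFn_toLp, ha1] with t h1 h2
    change ‖(hm g).toLp _ t‖ ≤ _
    rw [h1, norm_mul, h2, one_mul]
  exact ⟨L.mkContinuous 1 hL, fun g => by simpa using hL g, fun g => (hm g).coeFn_toLp⟩

theorem inner_mulOp {a : 𝕋 → ℂ} {M M' : L2 →L[ℂ] L2} (hM : ∀ g, M g =ᵐ[haar] fun t => a t * g t)
    (hM' : ∀ g, M' g =ᵐ[haar] fun t => (starRingEnd ℂ) (a t) * g t) (g h : L2) :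
    inner ℂ (M g) h = inner ℂ g (M' h) := by
  rw [L2.inner_def, L2.inner_def]
  refine integral_congr_ae ?_
  filter_upwards [hM g, hM' h] with t h1 h2
  rw [h1, h2, RCLike.inner_apply', RCLike.inner_apply', map_mul]
  ring

theorem fourierBasis_repr_mulOp_basis {a : 𝕋 → ℂ} {M : L2 →L[ℂ] L2}
    (hM : ∀ g, M g =ᵐ[haar] fun t => a t * g t) (k j : ℤ) :
    fourierBasis.repr (M (fourierBasis k)) j = fourierCoeff a (j - k) := by
  rw [fourierBasis_repr, ← fourierCoeff_fourier_mul]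
  refine congrFun (fourierCoeff_congr_ae ?_) j
  filter_upwards [hM (fourierBasis k), coeFn_fourierLp (T := 2 * Real.pi) 2 k] with t h1 h2
  rw [h1, coe_fourierBasis, h2, mul_comm]

/-- For a unimodular function `a` whose Hankel tail `∑_{m ≥ n} (m + 1) |a_m|²` is less than `1`,
the finite section equations at level `n` are solvable, with a bound on the solution. -/
theorem exists_hankel_solution {a : 𝕋 → ℂ} (ha : AEStronglyMeasurable a haar)
    (ha1 : ∀ᵐ t ∂haar, ‖a t‖ = 1)
    (hs : Summable fun m : ℕ => ((m : ℝ) + 1) * ‖fourierCoeff a m‖ ^ 2) (n : ℕ)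
    {ρ : ℝ} (hρ0 : 0 ≤ ρ) (hρ1 : ρ < 1)
    (hρ : ∑' m : ℕ, (((n + m : ℕ) : ℝ) + 1) * ‖fourierCoeff a ((n + m : ℕ) : ℤ)‖ ^ 2 ≤ ρ ^ 2) :
    ∃ X Y : 𝕋 → ℂ, MemLp X 2 haar ∧ MemLp Y 2 haar ∧
      (∀ k < (n : ℤ), fourierCoeff X k = 0) ∧ (∀ k ≥ (0 : ℤ), fourierCoeff Y k = 0) ∧
      (∀ k > (n : ℤ), fourierCoeff (fun t => X t + a t * Y t) k = 0) ∧
      fourierCoeff (fun t => X t + a t * Y t) n = 1 ∧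
      (∀ k < (0 : ℤ), fourierCoeff (fun t => (starRingEnd ℂ) (a t) * X t + Y t) k = 0) ∧
      ‖fourierCoeff (fun t => (starRingEnd ℂ) (a t) * X t + Y t) 0‖ ≤ ‖fourierCoeff a n‖ +
        (∑' m : ℕ, ‖fourierCoeff a ((n + m : ℕ) : ℤ)‖ ^ 2) * (ρ / (1 - ρ ^ 2)) := by
  have ha' : AEStronglyMeasurable (fun t => (starRingEnd ℂ) (a t)) haar :=
    Complex.continuous_conj.comp_aestronglyMeasurable ha
  have ha1' : ∀ᵐ t ∂haar, ‖(starRingEnd ℂ) (a t)‖ = 1 := by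
    filter_upwards [ha1] with t ht
    rw [RCLike.norm_conj, ht]
  obtain ⟨M, hMn, hM⟩ := exists_mulOp ha ha1
  obtain ⟨M', hMn', hM'⟩ := exists_mulOp ha' ha1'
  have hadj := inner_mulOp hM hM'
  set u : ℕ → ℝ := fun m => ‖fourierCoeff a m‖ ^ 2 with hu
  have hu0 : ∀ m, 0 ≤ u m := fun m => by positivity
  have hu1 : Summable u := hs.of_nonneg_of_le hu0 fun m =>
    le_mul_of_one_le_left (hu0 m) (by linarith [(Nat.cast_nonneg m : (0 : ℝ) ≤ m)])
  set S : ℕ → ℝ := fun k => ∑' m, u (k + m) with hS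
  have hS0 : ∀ k, 0 ≤ S k := fun k => tsum_nonneg fun m => hu0 _
  have hSsum : ∀ k, Summable fun m => u (k + m) := fun k => by
    simpa only [add_comm k] using (summable_nat_add_iff k).2 hu1
  have hSanti : ∀ k, S (k + 1) ≤ S k := fun k => by
    have := (hSsum k).sum_add_tsum_nat_add 1
    simp only [Finset.range_one, Finset.sum_singleton] at this
    have e : S (k + 1) = ∑' i, u (k + (i + 1)) := tsum_congr fun m => by congr 1; ring
    rw [e]
    change _ ≤ ∑' i, u (k + i)
    linarith [hu0 (k + 0)]
  set Pm := freqProj (Set.Iio 0) with hPm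
  set Pp := freqProj (Set.Ici (n : ℤ)) with hPp
  have hr : Set.range (fun i : ℕ => ((n + i : ℕ) : ℤ)) = Set.Ici (n : ℤ) := by
    ext z
    simp only [Set.mem_range, Set.mem_Ici]
    exact ⟨fun ⟨i, hi⟩ => by omega, fun hz => ⟨(z - n).toNat, by omega⟩⟩
  -- The coefficients at `-(i+1)` are `conj (a_{k+i+1})`: frequency `-1` comes first, so the tail
  -- starts at `k + 1`.
  have hrow : ∀ k : ℕ, ‖Pm (M' (fourierBasis (k : ℤ)))‖ ^ 2 = S (k + 1) := fun k => by
    have hr : Set.range (fun i : ℕ => -((i : ℤ) + 1)) = Set.Iio 0 := by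
      ext z
      simp only [Set.mem_range, Set.mem_Iio]
      exact ⟨fun ⟨i, hi⟩ => by omega, fun hz => ⟨(-z - 1).toNat, by omega⟩⟩
    have h1 := hasSum_norm_sq_repr_comp (φ := fun i : ℕ => -((i : ℤ) + 1))
      (fun i j hij => by simpa using hij) (g := Pm (M' (fourierBasis (k : ℤ))))
      (by rw [hr]; exact freqProj_mem _ _)
    rw [← h1.tsum_eq]
    refine tsum_congr fun i => ?_
    rw [fourierBasis_repr_freqProj_of_mem _ (by simp only [Set.mem_Iio]; omega),
      fourierBasis_repr_mulOp_basis hM', fourierCoeff_conj, RCLike.norm_conj]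
    simp only [hu]
    congr 3
    push_cast
    ring
  have hcol : ‖Pp (M (fourierBasis (0 : ℤ)))‖ ^ 2 = S n := by
    have h1 := hasSum_norm_sq_repr_comp (φ := fun i : ℕ => ((n + i : ℕ) : ℤ))
      (fun i j hij => by simpa using hij) (g := Pp (M (fourierBasis (0 : ℤ))))
      (by rw [hr]; exact freqProj_mem _ _)
    rw [← h1.tsum_eq]
    refine tsum_congr fun i => ?_
    rw [fourierBasis_repr_freqProj_of_mem _ (by simp only [Set.mem_Ici]; omega),
      fourierBasis_repr_mulOp_basis hM, sub_zero]
  set T : L2 →L[ℂ] L2 := Pp ∘L M ∘L Pm with hT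
  set T' : L2 →L[ℂ] L2 := Pm ∘L M' ∘L Pp with hT'
  have hTadj : ∀ g h, inner ℂ (T g) h = inner ℂ g (T' h) := fun g h => by
    simp only [hT, hT', ContinuousLinearMap.comp_apply]
    rw [inner_freqProj_left, hadj, inner_freqProj_left]
  -- Row by row Cauchy–Schwarz: row `n + i` has squared norm `S (n + i + 1)`, and the sum over `i`
  -- is the squared Hilbert–Schmidt norm `∑ (m + 1) |a_{n+1+m}|²`.
  have hTn : ∀ g, ‖T g‖ ≤ ρ * ‖g‖ := fun g => by
    have h1 := hasSum_norm_sq_repr_comp (φ := fun i : ℕ => ((n + i : ℕ) : ℤ))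
      (fun i j hij => by simpa using hij) (g := T g)
      (by rw [hr]; exact freqProj_mem _ _)
    have h2 : ∀ i : ℕ, ‖fourierBasis.repr (T g) ((n + i : ℕ) : ℤ)‖ ^ 2 ≤
        S (n + i + 1) * ‖g‖ ^ 2 := fun i => by
      rw [← hrow, ← mul_pow]
      gcongr
      simp only [hT, ContinuousLinearMap.comp_apply]
      rw [fourierBasis_repr_freqProj_of_mem _ (by simp only [Set.mem_Ici]; omega),
        fourierBasis.repr_apply_apply, ← inner_conj_symm, RCLike.norm_conj, hadj,
        inner_freqProj_left, ← inner_conj_symm, RCLike.norm_conj]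
      exact norm_inner_le_norm _ _
    have h3 : Summable fun m : ℕ => ((m : ℝ) + 1) * u (n + 1 + m) := by
      have h4 := (summable_nat_add_iff (n + 1)).2 hs
      refine h4.of_nonneg_of_le (fun m => mul_nonneg (by positivity) (hu0 _)) fun m => ?_
      rw [add_comm (n + 1) m]
      refine mul_le_mul_of_nonneg_right ?_ (hu0 _)
      push_cast
      linarith [(Nat.cast_nonneg n : (0 : ℝ) ≤ n)]
    have h4 := hasSum_tsum_nat_add (u := fun m => u (n + 1 + m)) (fun m => hu0 _) h3
    have h5 : ∑' m : ℕ, ((m : ℝ) + 1) * u (n + 1 + m) ≤ ρ ^ 2 := by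
      refine le_trans ?_ hρ
      have h6 : Summable fun m : ℕ => (((n + m : ℕ) : ℝ) + 1) * u (n + m) := by
        simpa only [add_comm n] using (summable_nat_add_iff n).2 hs
      rw [h6.tsum_eq_zero_add]
      refine le_trans ?_ (le_add_of_nonneg_left (mul_nonneg (by positivity) (hu0 _)))
      refine h3.tsum_le_tsum (fun m => ?_) ((summable_nat_add_iff 1).2 h6)
      have e : n + 1 + m = n + (m + 1) := by ring
      rw [e]
      refine mul_le_mul_of_nonneg_right ?_ (hu0 _)
      push_cast
      linarith [(Nat.cast_nonneg n : (0 : ℝ) ≤ n)]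
    have h6 : ‖T g‖ ^ 2 ≤ (ρ * ‖g‖) ^ 2 := by
      have h7 : HasSum (fun i : ℕ => S (n + i + 1)) (∑' m : ℕ, ((m : ℝ) + 1) * u (n + 1 + m)) := by
        convert h4 using 1
        ext i
        refine tsum_congr fun m => ?_
        congr 1
        ring
      refine (hasSum_le h2 h1 (h7.mul_right (‖g‖ ^ 2))).trans ?_
      rw [mul_pow]
      gcongr
    exact (sq_le_sq₀ (norm_nonneg _) (by positivity)).1 h6
  obtain ⟨X, Y, hX, hY, hYn⟩ := exists_sub_apply_eq T T' hTadj hρ0 hρ1 hTn (fourierBasis (n : ℤ))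
  have hen : (fourierBasis (n : ℤ) : L2) ∈ freqSubspace (Set.Ici (n : ℤ)) := fun k hk => by
    rw [fourierBasis_repr_basis, if_neg]
    rintro rfl
    exact hk (Set.mem_Ici.2 le_rfl)
  have hXm : X ∈ freqSubspace (Set.Ici (n : ℤ)) := by
    rw [hX]
    exact Submodule.sub_mem _ hen (freqProj_mem _ _)
  have hYm : Y ∈ freqSubspace (Set.Iio (0 : ℤ)) := by
    rw [hY]
    exact Submodule.neg_mem _ (freqProj_mem _ _)
  have hp : ∀ k : ℤ, fourierCoeff (fun t => X t + a t * Y t) k =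
      fourierBasis.repr (X + M Y) k := fun k => by
    rw [fourierBasis_repr]
    refine congrFun (fourierCoeff_congr_ae ?_) k
    filter_upwards [Lp.coeFn_add X (M Y), hM Y] with t h1 h2
    rw [h1, Pi.add_apply, h2]
  have hq : ∀ k : ℤ, fourierCoeff (fun t => (starRingEnd ℂ) (a t) * X t + Y t) k =
      fourierBasis.repr (M' X + Y) k := fun k => by
    rw [fourierBasis_repr]
    refine congrFun (fourierCoeff_congr_ae ?_) k
    filter_upwards [Lp.coeFn_add (M' X) Y, hM' X] with t h1 h2
    rw [h1, Pi.add_apply, h2]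
  -- On frequencies `≥ n` the function `a Y` agrees with `T Y`, and `X + T Y = e_n`.
  have hp' : ∀ k ≥ (n : ℤ), fourierBasis.repr (X + M Y) k =
      fourierBasis.repr (fourierBasis (n : ℤ) : L2) k := fun k hk => by
    have h1 : fourierBasis.repr (T Y) k = fourierBasis.repr (M Y) k := by
      simp only [hT, ContinuousLinearMap.comp_apply]
      rw [hPp, fourierBasis_repr_freqProj_of_mem (S := Set.Ici (n : ℤ)) _ hk, hPm, freqProj_eq_self hYm]
    rw [map_add, lp.coeFn_add, Pi.add_apply, ← h1, ← Pi.add_apply, ← lp.coeFn_add, ← map_add]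
    nth_rw 1 [hX]
    rw [sub_add_cancel]
  refine ⟨X, Y, Lp.memLp X, Lp.memLp Y, fun k hk => ?_, fun k hk => ?_, fun k hk => ?_, ?_,
    fun k hk => ?_, ?_⟩
  · rw [← fourierBasis_repr]
    exact hXm k (by simpa using hk)
  · rw [← fourierBasis_repr]
    exact hYm k (by simpa using hk)
  · rw [hp, hp' k hk.le, fourierBasis_repr_basis, if_neg hk.ne]
  · rw [hp, hp' n le_rfl, fourierBasis_repr_basis, if_pos rfl]
  · have h1 : fourierBasis.repr (T' X) k = fourierBasis.repr (M' X) k := by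
      simp only [hT', ContinuousLinearMap.comp_apply]
      rw [hPm, fourierBasis_repr_freqProj_of_mem (S := Set.Iio 0) _ hk, hPp, freqProj_eq_self hXm]
    rw [hq, map_add, lp.coeFn_add, Pi.add_apply, ← h1, ← Pi.add_apply, ← lp.coeFn_add, ← map_add]
    rw [hY, add_neg_cancel, map_zero, lp.coeFn_zero, Pi.zero_apply]
  -- `R` is the part of `a` with frequencies `≥ n`. Since `Y_0 = 0`, the coefficient in question is
  -- `⟨R, X⟩ = conj (a_n) - ⟨R, T Y⟩`; the factors `‖R‖` and `‖Y‖` each contribute `√(S n)`.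
  · set R := Pp (M (fourierBasis (0 : ℤ))) with hR
    have h1 : fourierBasis.repr (M' X + Y) 0 = inner ℂ R X := by
      rw [map_add, lp.coeFn_add, Pi.add_apply, hYm 0 (by simp), add_zero,
        fourierBasis.repr_apply_apply, ← hadj, hR, inner_freqProj_left, freqProj_eq_self hXm]
    have h2 : inner ℂ R (fourierBasis (n : ℤ)) = (starRingEnd ℂ) (fourierCoeff a n) := by
      rw [← inner_conj_symm, ← fourierBasis.repr_apply_apply, hR,
        fourierBasis_repr_freqProj_of_mem _ (Set.mem_Ici.2 le_rfl),
        fourierBasis_repr_mulOp_basis hM, sub_zero]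
    have hρ2 : 0 < 1 - ρ ^ 2 := by nlinarith
    have h3 : ‖T' (fourierBasis (n : ℤ))‖ ≤ √(S n) := by
      refine Real.le_sqrt_of_sq_le ?_
      simp only [hT', ContinuousLinearMap.comp_apply]
      rw [hPp, freqProj_eq_self hen, hrow]
      exact hSanti n
    have h4 : ‖R‖ = √(S n) := by rw [← hcol, Real.sqrt_sq (norm_nonneg _)]
    have h5 : ‖inner ℂ R (T Y)‖ ≤ S n * (ρ / (1 - ρ ^ 2)) := by
      have h6 : ‖Y‖ ≤ √(S n) / (1 - ρ ^ 2) := by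
        rw [le_div_iff₀ hρ2]
        linarith
      calc ‖inner ℂ R (T Y)‖ ≤ ‖R‖ * ‖T Y‖ := norm_inner_le_norm _ _
        _ ≤ √(S n) * (ρ * (√(S n) / (1 - ρ ^ 2))) := by
          rw [h4]
          gcongr
          exact (hTn Y).trans (mul_le_mul_of_nonneg_left h6 hρ0)
        _ = (√(S n) * √(S n)) * (ρ / (1 - ρ ^ 2)) := by ring
        _ = S n * (ρ / (1 - ρ ^ 2)) := by rw [Real.mul_self_sqrt (hS0 n)]
    rw [hq, h1, hX, inner_sub_right, h2]
    refine (norm_sub_le _ _).trans (add_le_add ?_ h5)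
    rw [RCLike.norm_conj]

/-! ### Characterization of the monic orthogonal polynomials -/

theorem circleInner_sub_left (μ : Measure 𝕋) [IsFiniteMeasure μ] (p p' q : ℂ[X]) :
    circleInner μ (p - p') q = circleInner μ p q - circleInner μ p' q := by
  simp only [circleInner, eval_sub, sub_mul]
  exact integral_sub (integrable_circleInner μ _ _) (integrable_circleInner μ _ _)

theorem circleInner_add_right (μ : Measure 𝕋) [IsFiniteMeasure μ] (p q q' : ℂ[X]) :
    circleInner μ p (q + q') = circleInner μ p q + circleInner μ p q' := by
  simp only [circleInner, eval_add, map_add, mul_add]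
  exact integral_add (integrable_circleInner μ _ _) (integrable_circleInner μ _ _)

theorem circleInner_C_mul_right (μ : Measure 𝕋) (p q : ℂ[X]) (c : ℂ) :
    circleInner μ p (C c * q) = (starRingEnd ℂ) c * circleInner μ p q := by
  simp only [circleInner, eval_mul, eval_C, map_mul]
  rw [← integral_const_mul]
  congr 1; ext t; ring

theorem circleInner_sum_right (μ : Measure 𝕋) [IsFiniteMeasure μ] {ι : Type*} (s : Finset ι)
    (p : ℂ[X]) (q : ι → ℂ[X]) :
    circleInner μ p (∑ i ∈ s, q i) = ∑ i ∈ s, circleInner μ p (q i) := by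
  classical
  induction s using Finset.induction_on with
  | empty => simp [circleInner]
  | insert a s ha ih => rw [Finset.sum_insert ha, Finset.sum_insert ha, circleInner_add_right, ih]

theorem circleInner_monicOPUC_X_pow (μ : Measure 𝕋) [IsFiniteMeasure μ]
    (hμ : IsNontrivialMeasure μ) {n j : ℕ} (hj : j < n) :
    circleInner μ (monicOPUC μ n) (X ^ j) = 0 := by
  have h := eq_add_of_sub_eq (monicOPUC_eq μ j).symm
  rw [h, circleInner_add_right, circleInner_monicOPUC μ hμ hj.ne', circleInner_sum_right, zero_add]
  refine Finset.sum_eq_zero fun k _ => ?_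
  rw [circleInner_C_mul_right, circleInner_monicOPUC μ hμ (k.2.trans hj).ne', mul_zero]

/-- The difference of the two polynomials has degree below `n` and is orthogonal to all such
polynomials, hence to itself. -/
theorem eq_monicOPUC (μ : Measure 𝕋) [IsFiniteMeasure μ] (hμ : IsNontrivialMeasure μ) {n : ℕ}
    {Q : ℂ[X]} (hQ : Q.Monic) (hn : Q.natDegree = n)
    (horth : ∀ j < n, circleInner μ Q (X ^ j) = 0) : Q = monicOPUC μ n := by
  obtain ⟨hΦ, hΦn⟩ := monicOPUC_monic_natDegree μ n
  by_contra hne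
  have hd : Q - monicOPUC μ n ≠ 0 := sub_ne_zero.2 hne
  refine circleInner_self_ne_zero μ hμ hd ?_
  have hdeg : (Q - monicOPUC μ n).natDegree < n := by
    rw [natDegree_lt_iff_degree_lt hd]
    have h1 : Q.degree = (n : ℕ) := by rw [degree_eq_natDegree hQ.ne_zero, hn]
    have h2 : (monicOPUC μ n).degree = (n : ℕ) := by rw [degree_eq_natDegree hΦ.ne_zero, hΦn]
    rw [← h1]
    exact degree_sub_lt_left (h1.trans h2.symm) hQ.ne_zero (hQ.leadingCoeff.trans hΦ.leadingCoeff.symm)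
  have h1 : ∀ j < n, circleInner μ (Q - monicOPUC μ n) (X ^ j) = 0 := fun j hj => by
    rw [circleInner_sub_left, horth j hj, circleInner_monicOPUC_X_pow μ hμ hj, sub_zero]
  conv_lhs =>
    arg 3
    rw [(Q - monicOPUC μ n).as_sum_range' n hdeg]
  rw [circleInner_sum_right]
  refine Finset.sum_eq_zero fun j hj => ?_
  rw [← C_mul_X_pow_eq_monomial, circleInner_C_mul_right, h1 j (Finset.mem_range.1 hj), mul_zero]

theorem MeasureTheory.MemLp.eval_mul {g : 𝕋 → ℂ} (hg : MemLp g 2 haar) (P : ℂ[X]) :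
    MemLp (fun t => P.eval (fourier 1 t : ℂ) * g t) 2 haar := by
  obtain ⟨M, hM⟩ := (isCompact_range (continuous_eval_fourier P)).isBounded.exists_norm_le
  refine hg.of_le_mul (c := M) ((continuous_eval_fourier P).aestronglyMeasurable.mul hg.1)
    (Filter.Eventually.of_forall fun t => ?_)
  rw [norm_mul]
  exact mul_le_mul_of_nonneg_right (hM _ ⟨t, rfl⟩) (norm_nonneg _)

/-- If `D` is an outer function with `conj D = a D` and `μ` is a multiple of `|D|² |dz|`, then the
solution of the finite section equations for `a` at level `n` determines `Φ_n`. -/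
theorem monicOPUC_eval_zero_eq (μ : Measure 𝕋) [IsFiniteMeasure μ] (hμ : IsNontrivialMeasure μ)
    {D D' a X Y : 𝕋 → ℂ} {n : ℕ} {c : ℂ} (hD : MemLp D 2 haar) (hD' : MemLp D' 2 haar)
    (hDn : ∀ k < (0 : ℤ), fourierCoeff D k = 0) (hDn' : ∀ k < (0 : ℤ), fourierCoeff D' k = 0)
    (hD0' : fourierCoeff D' 0 = 1) (hDD : ∀ t, D t * D' t = 1)
    (ha : AEStronglyMeasurable a haar) (ha1 : ∀ᵐ t ∂haar, ‖a t‖ = 1)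
    (haD : ∀ᵐ t ∂haar, a t * D t = (starRingEnd ℂ) (D t))
    (hμD : ∀ P Q : ℂ[X], circleInner μ P Q = c * ∫ t, P.eval (fourier 1 t : ℂ) *
      (starRingEnd ℂ) (Q.eval (fourier 1 t : ℂ)) * ((starRingEnd ℂ) (D t) * D t) ∂haar)
    (hX : MemLp X 2 haar) (hY : MemLp Y 2 haar)
    (hXn : ∀ k < (n : ℤ), fourierCoeff X k = 0) (hYn : ∀ k ≥ (0 : ℤ), fourierCoeff Y k = 0)
    (hp : ∀ k > (n : ℤ), fourierCoeff (fun t => X t + a t * Y t) k = 0)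
    (hpn : fourierCoeff (fun t => X t + a t * Y t) n = 1)
    (hq : ∀ k < (0 : ℤ), fourierCoeff (fun t => (starRingEnd ℂ) (a t) * X t + Y t) k = 0) :
    (monicOPUC μ n).eval 0 = fourierCoeff (fun t => (starRingEnd ℂ) (a t) * X t + Y t) 0 := by
  set p : 𝕋 → ℂ := fun t => X t + a t * Y t with hpdef
  set q : 𝕋 → ℂ := fun t => (starRingEnd ℂ) (a t) * X t + Y t with hqdef
  have ha1' : ∀ᵐ t ∂haar, ‖(starRingEnd ℂ) (a t)‖ = 1 := by
    filter_upwards [ha1] with t ht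
    rw [RCLike.norm_conj, ht]
  have hpm : MemLp p 2 haar := hX.add (hY.unimodular_mul ha ha1)
  have hqm : MemLp q 2 haar := (hX.unimodular_mul
    (Complex.continuous_conj.comp_aestronglyMeasurable ha) ha1').add hY
  have haa : ∀ᵐ t ∂haar, (starRingEnd ℂ) (a t) * a t = 1 := by
    filter_upwards [ha1] with t ht
    rw [mul_comm, Complex.mul_conj, Complex.normSq_eq_norm_sq, ht]
    simp
  have hDc : ∀ k > (0 : ℤ), fourierCoeff (fun t => (starRingEnd ℂ) (D t)) k = 0 := fun k hk => by
    rw [fourierCoeff_conj, hDn _ (by omega), map_zero]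
  have hDc' : ∀ k > (0 : ℤ), fourierCoeff (fun t => (starRingEnd ℂ) (D' t)) k = 0 := fun k hk => by
    rw [fourierCoeff_conj, hDn' _ (by omega), map_zero]
  set φ : ℤ → ℂ := fourierCoeff (fun t => q t * D' t) with hφ
  -- From `q = conj(a) p` and `conj(a) D' = conj D'`. The first form of the product bounds the
  -- frequencies from below by `0`, the second from above by `n`.
  have hφ' : φ = fourierCoeff (fun t => p t * (starRingEnd ℂ) (D' t)) := by
    refine fourierCoeff_congr_ae ?_
    filter_upwards [haa, haD] with t h1 h2
    have h3 : (starRingEnd ℂ) (D t) * (starRingEnd ℂ) (D' t) = 1 := by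
      rw [← map_mul, hDD, map_one]
    have h4 : (starRingEnd ℂ) (a t) * D' t = (starRingEnd ℂ) (D' t) := by
      rw [← h2] at h3
      calc (starRingEnd ℂ) (a t) * D' t = (starRingEnd ℂ) (a t) * D' t *
            (a t * D t * (starRingEnd ℂ) (D' t)) := by rw [h3, mul_one]
        _ = ((starRingEnd ℂ) (a t) * a t) * (D t * D' t) * (starRingEnd ℂ) (D' t) := by ring
        _ = _ := by rw [h1, hDD, one_mul, one_mul]
    have h5 : q t = (starRingEnd ℂ) (a t) * p t := by
      simp only [hqdef, hpdef, mul_add, ← mul_assoc, h1, one_mul]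
    rw [h5, mul_right_comm, h4, mul_comm]
  have hφn : φ n = 1 := by
    have h1 := fourierCoeff_mul_of_upper hpm hD'.conj hp hDc'
    rw [add_zero] at h1
    rw [hφ', h1, hpn, fourierCoeff_conj, neg_zero, hD0', map_one, one_mul]
  have hφup : ∀ k : ℤ, (n : ℤ) < k → φ k = 0 := fun k hk => by
    rw [hφ']
    exact fourierCoeff_mul_eq_zero_of_upper hpm hD'.conj hp hDc' (by simpa using hk)
  have hφ0 : φ 0 = fourierCoeff q 0 := by
    have h1 := fourierCoeff_mul_of_lower hqm hD' hq hDn'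
    rw [add_zero] at h1
    rw [hφ, h1, hD0', mul_one]
  set Q : ℂ[X] := ∑ k ∈ Finset.range (n + 1), monomial k (φ k) with hQ
  have hQc : ∀ k : ℕ, Q.coeff k = φ k := fun k => by
    have : Q.coeff k = if k < n + 1 then φ k else 0 := by simp [hQ, coeff_monomial]
    rw [this]
    split_ifs with h
    · rfl
    · rw [hφup]
      omega
  have hQdeg : Q.natDegree ≤ n := natDegree_le_iff_coeff_eq_zero.2 fun k hk => by
    rw [hQc, hφup]
    omega
  have hQmonic : Q.Monic := monic_of_natDegree_le_of_coeff_eq_one n hQdeg (by rw [hQc, hφn])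
  have hQn : Q.natDegree = n := le_antisymm hQdeg
    (le_natDegree_of_ne_zero (by rw [hQc, hφn]; exact one_ne_zero))
  -- The product `q D'` is known only to be in `L¹`, so it is not compared with `Q` directly.
  -- Multiplying back by `D` as formal power series gives equal coefficients of two `L²` functions.
  have hQD : (fun t => Q.eval (fourier 1 t : ℂ) * D t) =ᵐ[haar] q := by
    refine ae_eq_of_fourierCoeff_eq (hD.eval_mul Q) hqm fun k => ?_
    have hQneg : ∀ k < (0 : ℤ), fourierCoeff (fun t : 𝕋 => Q.eval (fourier 1 t : ℂ)) k = 0 :=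
      fun k hk => by rw [fourierCoeff_eval, if_neg hk.not_ge]
    rcases lt_or_ge k 0 with hk | hk
    · rw [hq k hk]
      exact fourierCoeff_mul_eq_zero_of_lower (continuous_eval_fourier Q).memLp_circle hD hQneg hDn
        (by simpa using hk)
    · lift k to ℕ using hk
      rw [fourierCoeff_mul_natCast (continuous_eval_fourier Q).memLp_circle hD hQneg hDn]
      let e : PowerSeries ℂ := PowerSeries.mk fun k => fourierCoeff D k
      let e' : PowerSeries ℂ := PowerSeries.mk fun k => fourierCoeff D' k
      let f : PowerSeries ℂ := PowerSeries.mk fun k => fourierCoeff q k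
      have h1 : e' * e = 1 := by
        ext m
        rw [mul_comm, PowerSeries.coeff_mul]
        simp only [e, e', PowerSeries.coeff_mk]
        rw [← fourierCoeff_mul_natCast hD hD' hDn hDn']
        simp only [hDD, PowerSeries.coeff_one]
        have h2 := fourierCoeff_eval (1 : ℂ[X]) m
        simp only [eval_one] at h2
        rw [h2]
        simp [coeff_one]
      have h2 : PowerSeries.mk (fun k : ℕ => φ k) = f * e' := by
        ext m
        rw [PowerSeries.coeff_mul]
        simp only [f, e', PowerSeries.coeff_mk]
        rw [← fourierCoeff_mul_natCast hqm hD' hq hDn']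
      have h3 : PowerSeries.mk (fun k : ℕ => φ k) * e = f := by
        rw [h2, mul_assoc, h1, mul_one]
      have h4 := congrArg (PowerSeries.coeff k) h3
      rw [PowerSeries.coeff_mul] at h4
      simp only [f, e, PowerSeries.coeff_mk] at h4
      rw [← h4]
      refine Finset.sum_congr rfl fun x _ => ?_
      rw [fourierCoeff_eval, if_pos (Int.natCast_nonneg _), Int.toNat_natCast, hQc]
  -- `Q |D|² = conj(D) q = D X + conj(D) Y`, whose two terms have frequencies `≥ n` and `≤ -1`; the
  -- coefficient at `0 ≤ j < n` vanishes.
  have horth : ∀ j < n, circleInner μ Q (Polynomial.X ^ j) = 0 := fun j hj => by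
    have h1 : ∫ t, Q.eval (fourier 1 t : ℂ) * (starRingEnd ℂ) ((Polynomial.X ^ j : ℂ[X]).eval
        (fourier 1 t : ℂ)) * ((starRingEnd ℂ) (D t) * D t) ∂haar =
        fourierCoeff ((fun t => D t * X t) + fun t => (starRingEnd ℂ) (D t) * Y t) j := by
      refine integral_congr_ae ?_
      filter_upwards [hQD, haa, haD] with t h1 h2 h3
      have h4 : (starRingEnd ℂ) (D t) * (starRingEnd ℂ) (a t) = D t := by
        rw [← h3, mul_comm, ← mul_assoc, h2, one_mul]
      rw [eval_pow, eval_X, fourier_one_pow, ← fourier_neg, smul_eq_mul, Pi.add_apply]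
      calc _ = fourier (-(j : ℤ)) t * ((starRingEnd ℂ) (D t) *
            (Q.eval (fourier 1 t : ℂ) * D t)) := by ring
        _ = _ := by
          rw [h1, hqdef]
          simp only [mul_add, ← mul_assoc, h4]
    rw [hμD, h1, fourierCoeff.add (f := fun t => D t * X t)
      (g := fun t => (starRingEnd ℂ) (D t) * Y t) (hD.integrable_mul hX)
      (hD.conj.integrable_mul hY), Pi.add_apply,
      fourierCoeff_mul_eq_zero_of_lower hD hX hDn hXn (by simpa using hj),
      fourierCoeff_mul_eq_zero_of_upper hD.conj hY hDc (b := -1) (fun k hk => hYn k (by omega))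
        (by omega), add_zero, mul_zero]
  rw [← eq_monicOPUC μ hμ hQmonic hQn horth, ← coeff_zero_eq_eval_zero, hQc, ← hφ0]
  rfl

/-! ### Weighted `ℓ²` estimates -/

/-- Minkowski's inequality in `ℓ²`, through partial sums so that summability comes out as well. -/
theorem summable_sq_and_sqrt_tsum_sq_le {v g h : ℕ → ℝ} {A B : ℝ} (hA : 0 ≤ A) (hB : 0 ≤ B)
    (hv0 : ∀ k, 0 ≤ v k) (hv : ∀ k, v k ≤ g k + h k)
    (hg : ∀ N, ∑ k ∈ Finset.range N, g k ^ 2 ≤ A ^ 2)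
    (hh : ∀ N, ∑ k ∈ Finset.range N, h k ^ 2 ≤ B ^ 2) :
    Summable (fun k => v k ^ 2) ∧ √(∑' k, v k ^ 2) ≤ A + B := by
  have h1 : ∀ N, ∑ k ∈ Finset.range N, v k ^ 2 ≤ (A + B) ^ 2 := fun N => by
    have h2 : ∑ k ∈ Finset.range N, v k ^ 2 ≤ ∑ k ∈ Finset.range N, (g k + h k) ^ 2 :=
      Finset.sum_le_sum fun k _ => pow_le_pow_left₀ (hv0 k) (hv k) 2
    have h3 : ∑ k ∈ Finset.range N, g k * h k ≤ A * B := by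
      refine abs_le_of_sq_le_sq' ?_ (by positivity) |>.2
      refine (Finset.sum_mul_sq_le_sq_mul_sq _ _ _).trans ?_
      rw [mul_pow]
      exact mul_le_mul (hg N) (hh N) (Finset.sum_nonneg fun k _ => sq_nonneg _) (sq_nonneg _)
    have h4 : ∑ k ∈ Finset.range N, (g k + h k) ^ 2 = ∑ k ∈ Finset.range N, g k ^ 2 +
        2 * ∑ k ∈ Finset.range N, g k * h k + ∑ k ∈ Finset.range N, h k ^ 2 := by
      rw [Finset.mul_sum, ← Finset.sum_add_distrib, ← Finset.sum_add_distrib]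
      exact Finset.sum_congr rfl fun k _ => by ring
    nlinarith [hg N, hh N]
  refine ⟨summable_of_sum_range_le (fun k => sq_nonneg _) h1, ?_⟩
  refine Real.sqrt_le_iff.2 ⟨by positivity, ?_⟩
  exact Real.tsum_le_of_sum_range_le (fun k => sq_nonneg _) h1

theorem summable_weighted_nat_add {u : ℕ → ℝ}
    (hs : Summable fun m : ℕ => ((m : ℝ) + 1) * u m) (n : ℕ) :
    Summable fun m : ℕ => (((n + m : ℕ) : ℝ) + 1) * u (n + m) := by
  simpa only [add_comm n] using (summable_nat_add_iff n).2 hs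

theorem tsum_weighted_nat_add_le {u : ℕ → ℝ} (hu : ∀ m, 0 ≤ u m)
    (hs : Summable fun m : ℕ => ((m : ℝ) + 1) * u m) (n k : ℕ) :
    ∑' m : ℕ, (((n + k + m : ℕ) : ℝ) + 1) * u (n + k + m) ≤
      ∑' m : ℕ, (((n + m : ℕ) : ℝ) + 1) * u (n + m) := by
  have h1 := (summable_weighted_nat_add hs n).sum_add_tsum_nat_add k
  rw [← h1]
  have e : ∑' m : ℕ, (((n + k + m : ℕ) : ℝ) + 1) * u (n + k + m) =
      ∑' m : ℕ, (((n + (m + k) : ℕ) : ℝ) + 1) * u (n + (m + k)) :=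
    tsum_congr fun m => by rw [show n + k + m = n + (m + k) by ring]
  rw [e]
  exact le_add_of_nonneg_left (Finset.sum_nonneg fun m _ => mul_nonneg (by positivity) (hu _))

/-- With `S_j` the tail sums of `u` and `R` the weighted tail, `j S_j ≤ R` for `j ≥ n` and `∑_{j ≥
n} S_j ≤ R`; one factor `S_j` is spent on each bound. -/
theorem sum_range_mul_sq_tail_le {u : ℕ → ℝ} (hu : ∀ m, 0 ≤ u m)
    (hs : Summable fun m : ℕ => ((m : ℝ) + 1) * u m) (n N : ℕ) :
    ∑ k ∈ Finset.range N, ((n + k : ℕ) : ℝ) * (∑' m, u (n + k + m)) ^ 2 ≤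
      (∑' m : ℕ, (((n + m : ℕ) : ℝ) + 1) * u (n + m)) ^ 2 := by
  set R := ∑' m : ℕ, (((n + m : ℕ) : ℝ) + 1) * u (n + m) with hR
  have hS0 : ∀ k, 0 ≤ ∑' m, u (n + k + m) := fun k => tsum_nonneg fun m => hu _
  have h1 : ∀ k, ((n + k : ℕ) : ℝ) * ∑' m, u (n + k + m) ≤ R := fun k => by
    refine le_trans ?_ (tsum_weighted_nat_add_le hu hs n k)
    rw [← tsum_mul_left]
    have h2 : ∀ m : ℕ, ((n + k : ℕ) : ℝ) * u (n + k + m) ≤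
        (((n + k + m : ℕ) : ℝ) + 1) * u (n + k + m) := fun m => by
      refine mul_le_mul_of_nonneg_right ?_ (hu _)
      push_cast
      linarith [(Nat.cast_nonneg m : (0 : ℝ) ≤ m)]
    have h3 := summable_weighted_nat_add hs (n + k)
    exact (h3.of_nonneg_of_le (fun m => mul_nonneg (by positivity) (hu _)) h2).tsum_le_tsum h2 h3
  have h2 : ∑ k ∈ Finset.range N, ∑' m, u (n + k + m) ≤ R := by
    have h3 : ∀ m : ℕ, ((m : ℝ) + 1) * u (n + m) ≤ (((n + m : ℕ) : ℝ) + 1) * u (n + m) :=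
      fun m => by
        refine mul_le_mul_of_nonneg_right ?_ (hu _)
        push_cast
        linarith [(Nat.cast_nonneg n : (0 : ℝ) ≤ n)]
    have h4 := summable_weighted_nat_add hs n
    have h5 := h4.of_nonneg_of_le (fun m => mul_nonneg (by positivity) (hu _)) h3
    have h6 := hasSum_tsum_nat_add (u := fun m => u (n + m)) (fun m => hu _) h5
    refine le_trans ?_ (h5.tsum_le_tsum h3 h4)
    simp only [add_assoc]
    exact sum_le_hasSum _ (fun k _ => tsum_nonneg fun m => hu _) h6
  have hR0 : 0 ≤ R := (mul_nonneg (by positivity) (hS0 0)).trans (h1 0)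
  calc ∑ k ∈ Finset.range N, ((n + k : ℕ) : ℝ) * (∑' m, u (n + k + m)) ^ 2
      ≤ ∑ k ∈ Finset.range N, R * ∑' m, u (n + k + m) := by
        refine Finset.sum_le_sum fun k _ => ?_
        rw [sq, ← mul_assoc]
        exact mul_le_mul_of_nonneg_right (h1 k) (hS0 k)
    _ ≤ R * R := by
        rw [← Finset.mul_sum]
        exact mul_le_mul_of_nonneg_left h2 hR0
    _ = R ^ 2 := (sq R).symm

/-! ### The Szegő function of a weight with logarithm in `H^{1/2}` -/

theorem MemHHalf.memHHalf_oddSeries {f : 𝕋 → ℂ} (hf : MemHHalf f) : MemHHalf (oddSeries f) := by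
  refine ⟨Lp.memLp _, hf.2.of_nonneg_of_le (fun k => by positivity) fun k => ?_⟩
  rw [fourierCoeff_oddSeries f hf.1, norm_mul, norm_neg]
  gcongr
  refine mul_le_of_le_one_left (norm_nonneg _) ?_
  rcases lt_trichotomy k 0 with h | h | h
  · simp [Int.sign_eq_neg_one_of_neg h]
  · simp [h]
  · simp [Int.sign_eq_one_of_pos h]

/-- A real function in `H^{1/2}` is `F + conj F` up to its mean, with `F` analytic. -/
theorem MemHHalf.exists_analytic_part {f : 𝕋 → ℂ} (hf : MemHHalf f)
    (hreal : ∀ t, (starRingEnd ℂ) (f t) = f t) :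
    ∃ F : 𝕋 → ℂ, MemLp F 2 haar ∧ (∀ k ≤ 0, fourierCoeff F k = 0) ∧
      (Summable fun k : ℕ => (k : ℝ) * ‖fourierCoeff F k‖ ^ 2) ∧
      (oddSeries f =ᵐ[haar] fun t => (starRingEnd ℂ) (F t) - F t) ∧
      f =ᵐ[haar] fun t => F t + (starRingEnd ℂ) (F t) + fourierCoeff f 0 := by
  have hsym : ∀ k, (starRingEnd ℂ) (fourierCoeff f (-k)) = fourierCoeff f k := fun k => by
    rw [← fourierCoeff_conj]
    simp only [hreal]
  obtain ⟨F, hF, hFc⟩ := exists_memLp_fourierCoeff_eq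
    (c := fun k : ℤ => if 0 < k then fourierCoeff f k else 0)
    ((hasSum_sq_fourierCoeff_of_memLp hf.1).summable.of_nonneg_of_le (fun k => by positivity)
      fun k => by split_ifs <;> simp)
  have hadd : ∀ (g h : 𝕋 → ℂ), MemLp g 2 haar → MemLp h 2 haar → ∀ k,
      fourierCoeff (fun t => g t + h t) k = fourierCoeff g k + fourierCoeff h k :=
    fun g h hg hh k => congrFun (fourierCoeff.add (hg.integrable one_le_two)
      (hh.integrable one_le_two)) k
  have hconst : ∀ (c : ℂ) (k : ℤ), fourierCoeff (fun _ : 𝕋 => c) k = if k = 0 then c else 0 :=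
    fun c k => by
      have := fourierCoeff_eval (C c) k
      simp only [eval_C] at this
      rw [this, coeff_C]
      split_ifs <;> first | rfl | omega
  refine ⟨F, hF, fun k hk => by rw [hFc, if_neg hk.not_gt], ?_, ?_, ?_⟩
  · have h1 := hf.2.comp_injective (Nat.cast_injective (R := ℤ))
    refine h1.of_nonneg_of_le (fun k => by positivity) fun k => ?_
    rw [hFc]
    simp only [Function.comp_apply, Int.cast_natCast, Nat.abs_cast]
    split_ifs
    · rfl
    · simp; positivity
  · refine ae_eq_of_fourierCoeff_eq (Lp.memLp _) (hF.conj.sub hF) fun k => ?_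
    have h1 := hadd _ _ hF.conj (hF.const_mul (-1)) k
    simp only [neg_one_mul, ← sub_eq_add_neg] at h1
    have h2 := fourierCoeff.const_mul F (-1) k
    simp only [neg_one_mul] at h2
    rw [fourierCoeff_oddSeries f hf.1]
    refine Eq.trans ?_ h1.symm
    rw [h2, fourierCoeff_conj, hFc, hFc]
    rcases lt_trichotomy k 0 with h | h | h
    · rw [if_pos (by omega), if_neg (by omega), hsym, Int.sign_eq_neg_one_of_neg h]
      simp
    · subst h; simp
    · rw [if_neg (by omega), if_pos h, Int.sign_eq_one_of_pos h]
      simp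
  · refine ae_eq_of_fourierCoeff_eq hf.1 ((hF.add hF.conj).add (memLp_const _)) fun k => ?_
    rw [hadd (fun t => F t + (starRingEnd ℂ) (F t)) _ (hF.add hF.conj) (memLp_const _) k,
      hadd _ _ hF hF.conj, hconst, fourierCoeff_conj, hFc, hFc]
    rcases lt_trichotomy k 0 with h | h | h
    · rw [if_neg (by omega), if_pos (by omega), if_neg (by omega), hsym]
      simp
    · subst h; simp
    · rw [if_pos h, if_neg (by omega), if_neg (by omega)]
      simp

/-- For a weight `w = exp f` the pairing of `w |dz| / 2π` is an integral against `exp f`. -/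
theorem circleInner_withDensity {w : 𝕋 → ℝ} (hw : ∀ᵐ t ∂haar, 0 < w t)
    (hm : AEStronglyMeasurable (fun t => (Real.log (w t) : ℂ)) haar) (P Q : ℂ[X]) :
    circleInner ((haar).withDensity fun t => ENNReal.ofReal (w t)) P Q =
      ∫ t, P.eval (fourier 1 t : ℂ) * (starRingEnd ℂ) (Q.eval (fourier 1 t : ℂ)) *
        Complex.exp (Real.log (w t)) ∂haar := by
  have h1 : AEMeasurable (fun t => Real.log (w t)) haar :=
    (Complex.measurable_re.comp_aemeasurable hm.aemeasurable).congr
      (Filter.Eventually.of_forall fun t => by simp)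
  have h2 : AEMeasurable (fun t => ENNReal.ofReal (w t)) haar := by
    refine (Real.measurable_exp.comp_aemeasurable h1).ennreal_ofReal.congr ?_
    filter_upwards [hw] with t ht
    simp [Real.exp_log ht]
  rw [circleInner, integral_withDensity_eq_integral_toReal_smul₀ h2
    (Filter.Eventually.of_forall fun t => ENNReal.ofReal_lt_top)]
  refine integral_congr_ae ?_
  filter_upwards [hw] with t ht
  rw [ENNReal.toReal_ofReal ht.le, ← Complex.ofReal_exp, Real.exp_log ht, Complex.real_smul,
    mul_comm]

theorem ae_re_oddSeries_eq_zero {f F : 𝕋 → ℂ}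
    (ho : oddSeries f =ᵐ[haar] fun t => (starRingEnd ℂ) (F t) - F t) :
    ∀ᵐ t ∂haar, (oddSeries f t).re = 0 := by
  filter_upwards [ho] with t ht
  rw [ht]
  simp

theorem summable_nat_of_memHHalf {g : 𝕋 → ℂ} (hg : MemHHalf g) :
    Summable fun m : ℕ => ((m : ℝ) + 1) * ‖fourierCoeff g m‖ ^ 2 := by
  have h1 := hg.2.comp_injective (Nat.cast_injective (R := ℤ))
  have h2 := (hasSum_sq_fourierCoeff_of_memLp hg.1).summable.comp_injective
    (Nat.cast_injective (R := ℤ))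
  refine (h1.add h2).congr fun m => ?_
  simp only [Function.comp_apply, Int.cast_natCast, Nat.abs_cast]
  ring

/-! ### The pointwise bound on the Verblunsky coefficients and the conclusion. -/

theorem norm_verblunsky_le (μ : Measure 𝕋) [IsProbabilityMeasure μ] (hμ : IsNontrivialMeasure μ)
    (w : 𝕋 → ℝ) (hw : ∀ᵐ t ∂haar, 0 < w t)
    (hμw : μ = (haar).withDensity fun t => ENNReal.ofReal (w t))
    (hlog : MemHHalf fun t => (Real.log (w t) : ℂ)) (hr : MemHHalf (reflectionFn w)) {n : ℕ}
    {ρ : ℝ} (hρ0 : 0 ≤ ρ) (hρ1 : ρ < 1)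
    (hρ : ∑' m : ℕ, (((n + 1 + m : ℕ) : ℝ) + 1) *
      ‖fourierCoeff (reflectionFn w) ((n + 1 + m : ℕ) : ℤ)‖ ^ 2 ≤ ρ ^ 2) :
    ‖verblunsky μ n‖ ≤ ‖fourierCoeff (reflectionFn w) ((n + 1 : ℕ) : ℤ)‖ +
      (∑' m : ℕ, ‖fourierCoeff (reflectionFn w) ((n + 1 + m : ℕ) : ℤ)‖ ^ 2) *
        (ρ / (1 - ρ ^ 2)) := by
  set f : 𝕋 → ℂ := fun t => (Real.log (w t) : ℂ) with hf
  obtain ⟨F, hF, hF0, hFs, hodd, hfF⟩ := hlog.exists_analytic_part fun t => Complex.conj_ofReal _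
  have hre := ae_re_oddSeries_eq_zero hodd
  have hr1 : ∀ᵐ t ∂haar, ‖reflectionFn w t‖ = 1 := by
    filter_upwards [hre] with t ht
    rw [reflectionFn, expOddSeries, Complex.norm_exp, ht, Real.exp_zero]
  have hFneg : ∀ k, fourierCoeff (fun t => -F t) k = -fourierCoeff F k := fun k => by
    have := fourierCoeff.const_mul F (-1) k
    simpa only [neg_one_mul] using this
  obtain ⟨hD, hDn, -⟩ := memLp_exp_of_analytic hF hF0 hFs
  obtain ⟨hD', hDn', hD0'⟩ := memLp_exp_of_analytic (F := fun t => -F t) hF.neg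
    (fun k hk => by rw [hFneg, hF0 k hk, neg_zero]) (by simpa only [hFneg, norm_neg] using hFs)
  -- The level is `n + 1` because `α_n` is read off from `Φ_{n+1}(0)`.
  obtain ⟨X, Y, hX, hY, hXn, hYn, hp, hpn, hq, hbound⟩ := exists_hankel_solution hr.1.1 hr1
    (summable_nat_of_memHHalf hr) (n + 1) hρ0 hρ1 hρ
  rw [verblunsky, norm_neg, RCLike.norm_conj,
    monicOPUC_eval_zero_eq μ hμ (c := Complex.exp (fourierCoeff f 0)) hD hD' hDn hDn' hD0'
      (fun t => by rw [← Complex.exp_add, add_neg_cancel, Complex.exp_zero]) hr.1.1 hr1 ?_ ?_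
      hX hY hXn hYn hp hpn hq]
  · exact hbound
  · filter_upwards [hodd] with t ht
    rw [reflectionFn, expOddSeries, ht, ← Complex.exp_add, sub_add_cancel, Complex.exp_conj]
  · intro P Q
    rw [hμw, circleInner_withDensity hw hlog.1.1, ← integral_const_mul]
    refine integral_congr_ae ?_
    filter_upwards [hfF] with t ht
    simp only [hf] at ht
    rw [ht, Complex.exp_add, Complex.exp_add, Complex.exp_conj]
    ring

theorem mainTheorem5
    (μ : Measure (AddCircle (2 * Real.pi))) [IsProbabilityMeasure μ]
    (hμ : IsNontrivialMeasure μ)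
    (w : AddCircle (2 * Real.pi) → ℝ)
    (hw : ∀ᵐ θ ∂(haarAddCircle : Measure (AddCircle (2 * Real.pi))), 0 < w θ)
    (hμw : μ = (haarAddCircle : Measure (AddCircle (2 * Real.pi))).withDensity
      fun θ => ENNReal.ofReal (w θ))
    (hlog : MemHHalf fun θ => (Real.log (w θ) : ℂ)) :
    Summable (fun n : ℕ => (n : ℝ) * ‖verblunsky μ n‖ ^ 2) ∧
    MemHHalf (reflectionFn w) ∧
    (∀ᶠ n₀ : ℕ in Filter.atTop, tailRho w n₀ < 1) ∧
    ∀ n₀ : ℕ, 1 ≤ n₀ → tailRho w n₀ < 1 →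
      Real.sqrt (∑' k : ℕ, ((n₀ + k : ℕ) : ℝ) * ‖verblunsky μ (n₀ + k - 1)‖ ^ 2) ≤
        tailRho w n₀ / (1 - tailRho w n₀ ^ 2) := by
  have hr : MemHHalf (reflectionFn w) := by
    obtain ⟨F, -, -, -, hodd, -⟩ := hlog.exists_analytic_part fun t => Complex.conj_ofReal _
    exact hlog.memHHalf_oddSeries.exp (ae_re_oddSeries_eq_zero hodd)
  set u : ℕ → ℝ := fun m => ‖fourierCoeff (reflectionFn w) m‖ ^ 2 with hudef
  have hu : ∀ m, 0 ≤ u m := fun m => sq_nonneg _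
  have hs : Summable fun m : ℕ => ((m : ℝ) + 1) * u m := summable_nat_of_memHHalf hr
  have hsq : ∀ n, tailRho w n ^ 2 = ∑' m : ℕ, (((n + m : ℕ) : ℝ) + 1) * u (n + m) := fun n =>
    Real.sq_sqrt (tsum_nonneg fun m => mul_nonneg (by positivity) (hu _))
  have hev : ∀ᶠ n₀ : ℕ in Filter.atTop, tailRho w n₀ < 1 := by
    have h1 := tendsto_sum_nat_add fun m : ℕ => ((m : ℝ) + 1) * u m
    filter_upwards [h1.eventually_lt_const one_pos] with n hn
    refine (sq_lt_one_iff₀ (a := tailRho w n) (Real.sqrt_nonneg _)).1 ?_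
    rw [hsq]
    simpa only [add_comm n] using hn
  have key : ∀ n₀ : ℕ, 1 ≤ n₀ → tailRho w n₀ < 1 →
      Summable (fun k : ℕ => ((n₀ + k : ℕ) : ℝ) * ‖verblunsky μ (n₀ + k - 1)‖ ^ 2) ∧
      √(∑' k : ℕ, ((n₀ + k : ℕ) : ℝ) * ‖verblunsky μ (n₀ + k - 1)‖ ^ 2) ≤
        tailRho w n₀ / (1 - tailRho w n₀ ^ 2) := by
    intro n₀ hn₀ hlt
    set ρ := tailRho w n₀ with hρ
    have hρ0 : 0 ≤ ρ := Real.sqrt_nonneg _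
    have hρ2 : 0 < 1 - ρ ^ 2 := by nlinarith
    set c := ρ / (1 - ρ ^ 2) with hc
    have hc0 : 0 ≤ c := by positivity
    -- The tails decrease, so the single value `ρ = ρ(n₀)` serves all levels `n₀ + k`.
    have h1 : ∀ k, ‖verblunsky μ (n₀ + k - 1)‖ ≤ ‖fourierCoeff (reflectionFn w) ((n₀ + k : ℕ) : ℤ)‖ +
        (∑' m, u (n₀ + k + m)) * c := fun k => by
      have e : n₀ + k - 1 + 1 = n₀ + k := by omega
      have h2 := norm_verblunsky_le μ hμ w hw hμw hlog hr (n := n₀ + k - 1) hρ0 hlt (by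
        rw [e, hsq]
        exact tsum_weighted_nat_add_le hu hs n₀ k)
      rwa [e] at h2
    -- `A = ρ` bounds the linear term, since `n ≤ n + 1`; `B = ρ² c` bounds the tail term, and `ρ +
    -- ρ² c = c`.
    have h2 := summable_sq_and_sqrt_tsum_sq_le
      (v := fun k => √((n₀ + k : ℕ) : ℝ) * ‖verblunsky μ (n₀ + k - 1)‖)
      (g := fun k => √((n₀ + k : ℕ) : ℝ) * ‖fourierCoeff (reflectionFn w) ((n₀ + k : ℕ) : ℤ)‖)
      (h := fun k => √((n₀ + k : ℕ) : ℝ) * ((∑' m, u (n₀ + k + m)) * c))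
      (A := ρ) (B := ρ ^ 2 * c) hρ0 (by positivity) (fun k => by positivity)
      (fun k => by rw [← mul_add]; exact mul_le_mul_of_nonneg_left (h1 k) (Real.sqrt_nonneg _))
      (fun N => ?_) (fun N => ?_)
    · simp only [mul_pow, Real.sq_sqrt (Nat.cast_nonneg _)] at h2
      refine ⟨h2.1, h2.2.trans (le_of_eq ?_)⟩
      rw [hc]
      field_simp
      ring
    · simp only [mul_pow, Real.sq_sqrt (Nat.cast_nonneg _)]
      rw [hρ, hsq]
      have h3 := summable_weighted_nat_add hs n₀
      refine le_trans (Finset.sum_le_sum fun k _ => ?_)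
        (h3.sum_le_tsum (Finset.range N) fun k _ => mul_nonneg (by positivity) (hu _))
      exact mul_le_mul_of_nonneg_right (by linarith) (hu _)
    · simp only [mul_pow, Real.sq_sqrt (Nat.cast_nonneg _), ← mul_assoc]
      rw [← Finset.sum_mul]
      refine mul_le_mul_of_nonneg_right ?_ (sq_nonneg _)
      rw [hρ, hsq]
      exact sum_range_mul_sq_tail_le hu hs n₀ N
  refine ⟨?_, hr, hev, fun n₀ h1 h2 => (key n₀ h1 h2).2⟩
  obtain ⟨n₀, h1, h2⟩ := ((Filter.eventually_ge_atTop 1).and hev).exists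
  obtain ⟨m, rfl⟩ : ∃ m, n₀ = m + 1 := ⟨n₀ - 1, by omega⟩
  -- Summability is unaffected by dropping the first `m = n₀ - 1` terms, and the weight `k + m` is
  -- at most the weight `n₀ + k` of `key`.
  rw [← summable_nat_add_iff m]
  refine (key _ h1 h2).1.of_nonneg_of_le (fun k => by positivity) fun k => ?_
  rw [show m + 1 + k - 1 = k + m by omega]
  refine mul_le_mul_of_nonneg_right ?_ (sq_nonneg _)
  push_cast
  linarith

end
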